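/- Let $T,\alpha,\beta>0$. Let $M(0,T)=C_0(0,T)^*$ be the space of Radon measures on $(0,T)$ with its total variation (dual) norm $\|\cdot\|_M$, and let $\mathrm{BV}(0,T)$ be the space of functions $u\in L^1(0,T)$ (equivalently, since $\mathrm{BV}(0,T)\subset L^\infty(0,T)$, $u\in L^2(0,T)$) whose distributional derivative $Du$ belongs to $M(0,T)$, with norm $\|u\|_{\mathrm{BV}}=\|u\|_{L^1}+\|Du\|_M$. Its weak* topology is the one induced by the embedding $u\mapsto(u\,\mathrm dx,Du)\in M(0,T)^2=(C_0(0,T)^2)^*$. For $u \in \mathrm{BV}(0,T)$ put $$\mathrm{TGV}(u)=\inf_{w\in \mathrm{BV}(0,T)}\ \alpha\|Du-w\|_M+\beta\|Dw\|_M ,$$ $$\partial_2\mathrm{TGV}(u)=\{\varphi\in L^2(0,T)\mid(\varphi,v-u)_{L^2}+\mathrm{TGV}(u)\le \mathrm{TGV}(v)\ \text{for all } v\in \mathrm{BV}(0,T)\}.$$ Let $\mathcal L$ be the space of affine linear functions on $(0,T)$, and for $x\in(0,T)$ let $S_x=1_{(x,T)}$ and $K_x(y)=1_{(0,x)}(y)\,(x-y)$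 if $x<T/2$, $K_x(y)=1_{(x,T)}(y)\,(y-x)$ if $x\ge T/2$. Let $\mathrm{Ext}\,B=\{\pm S_x/\alpha\mid x\in(0,T)\}\cup\{\pm K_x/\beta\mid x\in(\beta/\alpha,T-\beta/\alpha)\}$. Let $f:L^2(0,T)\to\mathbb R$ satisfy: (A1) $f$ is continuously Fréchet differentiable; (A2) $\nabla f:L^2(0,T)\to L^2(0,T)$ is Lipschitz continuous; (A3) $f\ge -C_f$ on $L^2(0,T)$ for some $C_f>0$; (A4) the sublevel sets of $J=f+\mathrm{TGV}$ are bounded in $\mathrm{BV}(0,T)$. For a finite set $\mathcal A\subset\mathrm{Ext}\,B$ let $(\mathcal P(\mathcal A))$ be the problem of minimizing $f\big(\sum_{a\in\mathcal A}\lambda_a a+\ell\big)+\sum_{a\in\mathcal A}\lambda_a$ over $\lambda\in[0,\infty)^{\mathcal A}$ and $\ell\in\mathcal L$. Consider the following algorithm, started from a finite set $\mathcal A_0\subset \mathrm{Ext}\,B$. Choose a minimizer $(\lambda,\ell)$ of $(\mathcal P(\mathcal A_0))$, set $u_1=\sum_{a\in\mathcal A_0}\lambda_a a+\ell$ and $\mathcal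 A_1=\{a\in\mathcal A_0\mid\lambda_a\neq0\}$. For $k=1,2,\dots$ set $p_k(x)=\int_0^x\nabla f(u_k)\,\mathrm ds$ and $P_k(x)=-\int_0^xp_k\,\mathrm ds$, and choose $\hat x^S_k,\hat x^K_k\in(0,T)$ with $|p_k(\hat x_k^S)|=\|p_k\|_C$ and $|P_k(\hat x_k^K)|=\|P_k\|_C$, where $\|\cdot\|_C$ is the supremum norm on $(0,T)$. If $\|p_k\|_C\le\alpha$ and $\|P_k\|_C\le\beta$, terminate. Otherwise set $$\widehat u_k=\begin{cases}\dfrac{\operatorname{sign}(p_k(\hat x_k^S))}{\alpha}\,S_{\hat x_k^S}&\text{if }\|p_k\|_C/\alpha\ge\|P_k\|_C/\beta,\\[2mm]\dfrac{\operatorname{sign}(P_k(\hat x_k^K))}{\beta}\,K_{\hat x_k^K}&\text{otherwise,}\end{cases}\qquad \mathcal A_k^+=\mathcal A_k\cup\{\widehat u_k\},$$ choose a minimizer $(\lambda,\ell)$ of $(\mathcal P(\mathcal A_k^+))$, and set $u_{k+1}=\sum_{a\in\mathcal A_k^+}\lambda_a a+\ell$ and $\mathcal A_{k+1}=\{a\in\mathcal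 A_k^+\mid\lambda_a\ne0\}$. Suppose that the algorithm does not terminate, and let $\{u_k\}_{k\ge1}$ be the sequence that it generates (for an arbitrary choice of the minimizers and of the points $\hat x_k^S,\hat x_k^K$). Then $\{u_k\}_k$ has at least one weak* accumulation point in $\mathrm{BV}(0,T)$, and some subsequence converges weakly* to such a point. Every weak* accumulation point $\bar u$ of $\{u_k\}_k$ is stationary, i.e. $-\nabla f(\bar u)\in\partial_2\mathrm{TGV}(\bar u)$. -/

import Mathlib

open MeasureTheory Set Filter Topology
open scoped ZeroAtInfty Distributions ContDiff

noncomputable section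

namespace TGV

/-! ### Function spaces on the interval `(0, T)` -/

/-- The open interval `(0, T)`, as a bundled open set. -/
def Omega (T : ℝ) : TopologicalSpace.Opens ℝ := ⟨Ioo 0 T, isOpen_Ioo⟩

/-- The Hilbert space `L²(0, T)`. -/
abbrev L2 (T : ℝ) : Type := Lp ℝ 2 (volume.restrict (Ioo 0 T))

/-- The space `C₀(0, T)` of continuous functions on `(0, T)` vanishing at the boundary, with the
uniform norm. -/
abbrev C0 (T : ℝ) : Type := C₀(Ioo (0 : ℝ) T, ℝ)

/-- Lebesgue measure on the subtype `(0, T)`. -/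
abbrev lebesgue (T : ℝ) : Measure (Ioo (0 : ℝ) T) := Measure.comap Subtype.val volume

/-- The space `M(0, T) = C₀(0, T)*` of Radon measures on `(0, T)`; its norm is the operator norm,
i.e. the total variation norm. -/
abbrev Radon (T : ℝ) : Type := StrongDual ℝ (C0 T)

/-- A test function `v ∈ C_c^∞(0, T)` as an element of `C₀(0, T)`. -/
def testToC0 {T : ℝ} (v : 𝓓(Omega T, ℝ)) : C0 T where
  toFun x := v x
  continuous_toFun := v.continuous.comp continuous_subtype_val
  zero_at_infty' := by
    have hK : IsCompact (Subtype.val ⁻¹' tsupport v : Set (Ioo (0 : ℝ) T)) :=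
      Topology.IsInducing.subtypeVal.isCompact_preimage' v.hasCompactSupport.isCompact
        (fun x hx => ⟨⟨x, v.tsupport_subset hx⟩, rfl⟩)
    refine tendsto_const_nhds.congr' ?_
    filter_upwards [hK.compl_mem_cocompact] with x hx
    exact (image_eq_zero_of_notMem_tsupport hx).symm

lemma integrable_coe {T : ℝ} (u : L2 T) : Integrable u (volume.restrict (Ioo 0 T)) :=
  (Lp.memLp u).integrable (by norm_num)

lemma integrable_coe_subtype {T : ℝ} (u : L2 T) :
    Integrable (fun x : Ioo (0 : ℝ) T => u x) (lebesgue T) :=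
  (integrableOn_iff_comap_subtypeVal measurableSet_Ioo).1 (integrable_coe u)

lemma integrable_C0_mul {T : ℝ} (φ : C0 T) (u : L2 T) :
    Integrable (fun x : Ioo (0 : ℝ) T => φ x * u x) (lebesgue T) :=
  (integrable_coe_subtype u).bdd_mul (c := ‖φ‖) φ.continuous.aestronglyMeasurable
    (Eventually.of_forall fun x => φ.toBCF.norm_coe_le_norm x)

/-- The measure `u · 𝓛` with Lebesgue density `u`, i.e. the functional `φ ↦ ∫ φ u`. -/
def toRadon {T : ℝ} (u : L2 T) : Radon T :=
  LinearMap.mkContinuous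
    { toFun := fun φ => ∫ x, φ x * u x ∂(lebesgue T)
      map_add' := fun φ ψ => by
        rw [← integral_add (integrable_C0_mul φ u) (integrable_C0_mul ψ u)]
        simp only [ZeroAtInftyContinuousMap.add_apply, add_mul]
      map_smul' := fun c φ => by
        simp only [ZeroAtInftyContinuousMap.smul_apply, smul_eq_mul, RingHom.id_apply, mul_assoc,
          integral_const_mul] }
    (∫ x, ‖u x‖ ∂(lebesgue T))
    (fun φ => by
      rw [← integral_mul_const]
      refine norm_integral_le_of_norm_le ((integrable_coe_subtype u).norm.mul_const _)
        (Eventually.of_forall fun x => ?_)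
      rw [norm_mul, mul_comm]
      exact mul_le_mul_of_nonneg_left (φ.toBCF.norm_coe_le_norm x) (norm_nonneg _))

/-- The Dirac measure `δ_x`. -/
def dirac {T : ℝ} (x : Ioo (0 : ℝ) T) : Radon T :=
  LinearMap.mkContinuous
    { toFun := fun φ => φ x
      map_add' := fun _ _ => rfl
      map_smul' := fun _ _ => rfl } 1
    (fun φ => by rw [one_mul]; exact φ.toBCF.norm_coe_le_norm x)

/-- `μ` is the distributional derivative of `u` on `(0, T)`. -/
def IsDistribDeriv {T : ℝ} (u : L2 T) (μ : Radon T) : Prop :=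
  ∀ v : 𝓓(Omega T, ℝ), μ (testToC0 v) = -∫ x in Ioo 0 T, u x * deriv v x

lemma integrable_mul_deriv {T : ℝ} (u : L2 T) (v : 𝓓(Omega T, ℝ)) :
    Integrable (fun x => u x * deriv v x) (volume.restrict (Ioo 0 T)) := by
  have hc : Continuous (deriv v) := v.contDiff.continuous_deriv (by simp)
  obtain ⟨C, hC⟩ := hc.bounded_above_of_compact_support v.hasCompactSupport.deriv
  exact (integrable_coe u).mul_bdd (c := C) hc.aestronglyMeasurable (Eventually.of_forall hC)

/-- The space `BV(0, T)` of functions whose distributional derivative is a Radon measure on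
`(0, T)`. It is realized inside `L²(0, T)`: every integrable function of bounded variation on a
bounded interval is bounded, and every element of `L²(0, T)` is integrable. -/
def BV (T : ℝ) : Submodule ℝ (L2 T) where
  carrier := {u | ∃ μ : Radon T, IsDistribDeriv u μ}
  zero_mem' := by
    refine ⟨0, fun v => ?_⟩
    have : (fun x => ((0 : L2 T) : ℝ → ℝ) x * deriv v x) =ᵐ[volume.restrict (Ioo 0 T)] fun _ => 0 := by
      filter_upwards [Lp.coeFn_zero ℝ 2 (volume.restrict (Ioo 0 T))] with x hx
      rw [hx, Pi.zero_apply, zero_mul]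
    rw [integral_congr_ae this]
    simp
  add_mem' := by
    rintro u w ⟨μ, hμ⟩ ⟨ν, hν⟩
    refine ⟨μ + ν, fun v => ?_⟩
    have : (fun x => ((u + w : L2 T) : ℝ → ℝ) x * deriv v x) =ᵐ[volume.restrict (Ioo 0 T)]
        fun x => u x * deriv v x + w x * deriv v x := by
      filter_upwards [Lp.coeFn_add u w] with x hx
      rw [hx, Pi.add_apply, add_mul]
    rw [integral_congr_ae this,
      integral_add (integrable_mul_deriv u v) (integrable_mul_deriv w v),
      add_apply, hμ v, hν v]
    ring
  smul_mem' := by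
    rintro c u ⟨μ, hμ⟩
    refine ⟨c • μ, fun v => ?_⟩
    have : (fun x => ((c • u : L2 T) : ℝ → ℝ) x * deriv v x) =ᵐ[volume.restrict (Ioo 0 T)]
        fun x => c * (u x * deriv v x) := by
      filter_upwards [Lp.coeFn_smul c u] with x hx
      rw [hx, Pi.smul_apply, smul_eq_mul, mul_assoc]
    rw [integral_congr_ae this, integral_const_mul, smul_apply, hμ v,
      smul_eq_mul]
    ring

/-- The distributional derivative `Du ∈ M(0, T)` of `u ∈ BV(0, T)`. -/
def D {T : ℝ} (u : BV T) : Radon T := u.2.choose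

/-- The norm `‖u‖_{BV} = ‖u‖_{L¹} + ‖Du‖_M`. -/
def bvNorm {T : ℝ} (u : BV T) : ℝ :=
  (∫ x in Ioo 0 T, |(u : L2 T) x|) + ‖D u‖

/-- The weak* topology of `BV(0, T)`: the topology induced by the embedding
`u ↦ (u · 𝓛, Du) ∈ M(0, T) × M(0, T) = (C₀(0, T) × C₀(0, T))*`, where `M(0, T) = C₀(0, T)*` carries
its weak* topology. -/
@[reducible] def weakStarTopology (T : ℝ) : TopologicalSpace (BV T) :=
  TopologicalSpace.induced
    (fun u => ((StrongDual.toWeakDual (toRadon (u : L2 T)), StrongDual.toWeakDual (D u)) :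
      WeakDual ℝ (C0 T) × WeakDual ℝ (C0 T)))
    inferInstance

/-- The sequence `u` converges weakly* in `BV(0, T)` to `ubar`. -/
def WeakStarTendsto {T : ℝ} (u : ℕ → BV T) (ubar : BV T) : Prop :=
  Tendsto u atTop (@nhds (BV T) (weakStarTopology T) ubar)

/-- `ubar` is a weak* accumulation point of the sequence `u`: every weak* neighbourhood of `ubar`
contains `u k` for infinitely many `k`. -/
def IsWeakStarAccPt {T : ℝ} (u : ℕ → BV T) (ubar : BV T) : Prop :=
  @MapClusterPt (BV T) (weakStarTopology T) ℕ ubar atTop u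

/-- The total generalized variation of order two,
`TGV(u) = inf_{w ∈ BV(0, T)} α ‖Du - w‖_M + β ‖Dw‖_M`. -/
def tgv {T : ℝ} (α β : ℝ) (u : BV T) : ℝ :=
  ⨅ w : BV T, (α * ‖D u - toRadon (w : L2 T)‖ + β * ‖D w‖)

/-- The `L²`-subdifferential `∂₂TGV(ubar)`. -/
def subdiffTGV {T : ℝ} (α β : ℝ) (ubar : BV T) : Set (L2 T) :=
  {φ | ∀ u : BV T, inner ℝ φ ((u : L2 T) - (ubar : L2 T)) + tgv α β ubar ≤ tgv α β u}

/-- The functional `J(u) = f(u) + TGV(u)`. -/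
def J {T : ℝ} (α β : ℝ) (f : L2 T → ℝ) (u : BV T) : ℝ := f (u : L2 T) + tgv α β u

/-! ### Affine functions, jumps and kinks -/

/-- The space `𝓛` of affine linear functions. -/
def affineFunctions (T : ℝ) : Set (BV T) :=
  {l | ∃ c d : ℝ, ∀ᵐ x ∂(volume.restrict (Ioo 0 T)), (l : L2 T) x = c * x + d}

lemma memLp_of_bound {T : ℝ} {h : ℝ → ℝ} (hm : Measurable h) (C : ℝ)
    (hC : ∀ y ∈ Ioo 0 T, |h y| ≤ C) : MemLp h 2 (volume.restrict (Ioo 0 T)) :=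
  MemLp.of_bound hm.aestronglyMeasurable C
    ((ae_restrict_iff' measurableSet_Ioo).2 (Eventually.of_forall hC))

lemma test_zero_right {T : ℝ} (v : 𝓓(Omega T, ℝ)) : v T = 0 :=
  image_eq_zero_of_notMem_tsupport fun h => lt_irrefl T (v.tsupport_subset h).2

lemma test_zero_left {T : ℝ} (v : 𝓓(Omega T, ℝ)) : v 0 = 0 :=
  image_eq_zero_of_notMem_tsupport fun h => lt_irrefl (0 : ℝ) (v.tsupport_subset h).1

lemma test_hasDerivAt {T : ℝ} (v : 𝓓(Omega T, ℝ)) (y : ℝ) : HasDerivAt v (deriv v y) y :=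
  (v.contDiff.differentiable (by simp) y).hasDerivAt

lemma test_continuous_deriv {T : ℝ} (v : 𝓓(Omega T, ℝ)) : Continuous (deriv v) :=
  v.contDiff.continuous_deriv (by simp)

/-- The characteristic function of `(x, T)`. -/
def jumpFun (T x : ℝ) : ℝ → ℝ := (Ioo x T).indicator fun _ => 1

lemma memLp_jumpFun (T x : ℝ) : MemLp (jumpFun T x) 2 (volume.restrict (Ioo 0 T)) :=
  memLp_of_bound (measurable_const.indicator measurableSet_Ioo) 1 fun y _ => by
    unfold jumpFun
    by_cases hy : y ∈ Ioo x T <;> simp [hy]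

lemma isDistribDeriv_jump {T : ℝ} (x : Ioo (0 : ℝ) T) :
    IsDistribDeriv ((memLp_jumpFun T x).toLp (jumpFun T x)) (dirac x) := by
  intro v
  have h1 : (fun y => (memLp_jumpFun T x).toLp (jumpFun T x) y * deriv v y)
      =ᵐ[volume.restrict (Ioo 0 T)] (Ioo (x : ℝ) T).indicator (deriv v) := by
    filter_upwards [(memLp_jumpFun T x).coeFn_toLp] with y hy
    rw [hy, jumpFun]
    by_cases hy' : y ∈ Ioo (x : ℝ) T <;> simp [hy']
  rw [integral_congr_ae h1, integral_indicator measurableSet_Ioo,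
    Measure.restrict_restrict measurableSet_Ioo,
    inter_eq_left.2 (Ioo_subset_Ioo_left x.2.1.le), ← integral_Ioc_eq_integral_Ioo,
    ← intervalIntegral.integral_of_le x.2.2.le,
    intervalIntegral.integral_eq_sub_of_hasDerivAt (fun y _ => test_hasDerivAt v y)
      ((test_continuous_deriv v).intervalIntegrable _ _), test_zero_right]
  simp [dirac, testToC0]

/-- The function `S_x = 1_{(x, T)}`. -/
def jump {T : ℝ} (x : Ioo (0 : ℝ) T) : BV T :=
  ⟨(memLp_jumpFun T x).toLp (jumpFun T x), dirac x, isDistribDeriv_jump x⟩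

/-- On `(0, T)`, the function `1_{(0, x)} (x - ·)` if `x < T / 2`, and `1_{(x, T)} (· - x)` if
`x ≥ T / 2`. -/
def kinkFun (T x : ℝ) : ℝ → ℝ := fun y =>
  if x < T / 2 then max (x - y) 0 else max (y - x) 0

/-- The derivative of `kinkFun T x` from the right. -/
def kinkDeriv (T x : ℝ) : ℝ → ℝ := fun y =>
  if x < T / 2 then (if y < x then -1 else 0) else (if y < x then 0 else 1)

lemma continuous_kinkFun (T x : ℝ) : Continuous (kinkFun T x) := by
  unfold kinkFun
  split_ifs <;> fun_prop

lemma memLp_kinkFun {T : ℝ} (x : Ioo (0 : ℝ) T) :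
    MemLp (kinkFun T x) 2 (volume.restrict (Ioo 0 T)) :=
  memLp_of_bound (continuous_kinkFun T x).measurable T fun y hy => by
    have h1 := x.2.1
    have h2 := x.2.2
    have h3 := hy.1
    have h4 := hy.2
    unfold kinkFun
    split_ifs <;> rw [abs_of_nonneg (le_max_right _ _)] <;> apply max_le <;> linarith

lemma memLp_kinkDeriv (T x : ℝ) : MemLp (kinkDeriv T x) 2 (volume.restrict (Ioo 0 T)) := by
  refine memLp_of_bound ?_ 1 fun y _ => ?_
  · unfold kinkDeriv
    by_cases h : x < T / 2 <;> simp only [h, if_true, if_false] <;>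
      exact Measurable.ite measurableSet_Iio measurable_const measurable_const
  · unfold kinkDeriv
    split_ifs <;> simp

lemma hasDerivWithinAt_kinkFun (T x y : ℝ) :
    HasDerivWithinAt (kinkFun T x) (kinkDeriv T x y) (Ioi y) y := by
  have key : ∀ (g : ℝ → ℝ) (c : ℝ), HasDerivAt g c y → kinkFun T x y = g y →
      (kinkFun T x =ᶠ[𝓝[>] y] g) → HasDerivWithinAt (kinkFun T x) c (Ioi y) y :=
    fun g c hg h0 he => hg.hasDerivWithinAt.congr_of_eventuallyEq he h0
  have hsub : HasDerivAt (fun z => x - z) (-1) y := by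
    simpa using (hasDerivAt_id y).const_sub x
  have hsub' : HasDerivAt (fun z => z - x) 1 y := by
    simpa using (hasDerivAt_id y).sub_const x
  by_cases hx : x < T / 2 <;> by_cases hy : y < x <;>
    simp only [kinkDeriv, hx, hy, if_true, if_false]
  · refine key (fun z => x - z) _ hsub ?_ ?_
    · simp [kinkFun, hx, hy.le]
    · filter_upwards [mem_nhdsWithin_of_mem_nhds (Iio_mem_nhds hy)] with z hz
      simp [kinkFun, hx, (mem_Iio.1 hz).le]
  · refine key (fun _ => 0) _ (hasDerivAt_const y 0) ?_ ?_
    · simpa [kinkFun, hx] using not_lt.1 hy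
    · filter_upwards [self_mem_nhdsWithin] with z hz
      simpa [kinkFun, hx] using (not_lt.1 hy).trans (mem_Ioi.1 hz).le
  · refine key (fun _ => 0) _ (hasDerivAt_const y 0) ?_ ?_
    · simpa [kinkFun, hx] using hy.le
    · filter_upwards [mem_nhdsWithin_of_mem_nhds (Iio_mem_nhds hy)] with z hz
      simpa [kinkFun, hx] using (mem_Iio.1 hz).le
  · refine key (fun z => z - x) _ hsub' ?_ ?_
    · simpa [kinkFun, hx] using not_lt.1 hy
    · filter_upwards [self_mem_nhdsWithin] with z hz
      simpa [kinkFun, hx] using (not_lt.1 hy).trans (mem_Ioi.1 hz).le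

lemma isDistribDeriv_kink {T : ℝ} (x : Ioo (0 : ℝ) T) :
    IsDistribDeriv ((memLp_kinkFun x).toLp (kinkFun T x))
      (toRadon ((memLp_kinkDeriv T x).toLp (kinkDeriv T x))) := by
  intro v
  have hT : (0 : ℝ) ≤ T := (x.2.1.trans x.2.2).le
  have e1 : toRadon ((memLp_kinkDeriv T x).toLp (kinkDeriv T x)) (testToC0 v)
      = ∫ y in (0 : ℝ)..T, kinkDeriv T x y * v y := by
    have : toRadon ((memLp_kinkDeriv T x).toLp (kinkDeriv T x)) (testToC0 v)
        = ∫ y in Ioo 0 T, v y * (memLp_kinkDeriv T x).toLp (kinkDeriv T x) y :=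
      integral_subtype_comap (μ := volume) measurableSet_Ioo
        (fun y => v y * (memLp_kinkDeriv T x).toLp (kinkDeriv T x) y)
    rw [this, intervalIntegral.integral_of_le hT, integral_Ioc_eq_integral_Ioo]
    refine integral_congr_ae ?_
    filter_upwards [(memLp_kinkDeriv T x).coeFn_toLp] with y hy
    rw [hy, mul_comm]
  have e2 : ∫ y in Ioo 0 T, (memLp_kinkFun x).toLp (kinkFun T x) y * deriv v y
      = ∫ y in (0 : ℝ)..T, kinkFun T x y * deriv v y := by
    rw [intervalIntegral.integral_of_le hT, integral_Ioc_eq_integral_Ioo]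
    refine integral_congr_ae ?_
    filter_upwards [(memLp_kinkFun x).coeFn_toLp] with y hy
    rw [hy]
  have hi : IntervalIntegrable (kinkDeriv T x) volume 0 T :=
    (intervalIntegrable_iff_integrableOn_Ioo_of_le hT).2
      ((memLp_kinkDeriv T x).integrable (by norm_num))
  rw [e1, e2, intervalIntegral.integral_mul_deriv_eq_deriv_mul_of_hasDeriv_right
    (continuous_kinkFun T x).continuousOn v.continuous.continuousOn
    (fun y _ => hasDerivWithinAt_kinkFun T x y)
    (fun y _ => (test_hasDerivAt v y).hasDerivWithinAt) hi
    ((test_continuous_deriv v).intervalIntegrable _ _), test_zero_right, test_zero_left]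
  ring

/-- The function `K_x`. -/
def kink {T : ℝ} (x : Ioo (0 : ℝ) T) : BV T :=
  ⟨(memLp_kinkFun x).toLp (kinkFun T x), _, isDistribDeriv_kink x⟩

/-- The set `Ext B = {±S_x / α | x ∈ (0, T)} ∪ {±K_x / β | x ∈ (β / α, T - β / α)}` of
representatives of the extremal points of the unit ball of `TGV` modulo affine functions. -/
def extB (T α β : ℝ) : Set (BV T) :=
  {a | ∃ (σ : ℝ) (x : Ioo (0 : ℝ) T), (σ = 1 ∨ σ = -1) ∧ a = (σ / α) • jump x} ∪
  {a | ∃ (σ : ℝ) (x : Ioo (0 : ℝ) T), (σ = 1 ∨ σ = -1) ∧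
    (x : ℝ) ∈ Ioo (β / α) (T - β / α) ∧ a = (σ / β) • kink x}

/-! ### The algorithm -/

/-- The function `∑_{a ∈ A} lam a • a + l`. -/
def combination {T : ℝ} (A : Finset (BV T)) (lam : BV T → ℝ) (l : BV T) : BV T :=
  ∑ a ∈ A, lam a • a + l

/-- The objective of the subproblem `(𝓟(A))`. -/
def subObjective {T : ℝ} (f : L2 T → ℝ) (A : Finset (BV T)) (lam : BV T → ℝ) (l : BV T) : ℝ :=
  f (combination A lam l : L2 T) + ∑ a ∈ A, lam a

/-- `(lam, l)` is admissible for `(𝓟(A))`: nonnegative weights on `A` and an affine function. -/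
def IsAdmissible {T : ℝ} (A : Finset (BV T)) (lam : BV T → ℝ) (l : BV T) : Prop :=
  (∀ a ∈ A, 0 ≤ lam a) ∧ l ∈ affineFunctions T

/-- `(lam, l)` is a (global) minimizer of `(𝓟(A))`. -/
def IsSubMinimizer {T : ℝ} (f : L2 T → ℝ) (A : Finset (BV T)) (lam : BV T → ℝ) (l : BV T) : Prop :=
  IsAdmissible A lam l ∧
    ∀ (lam' : BV T → ℝ) (l' : BV T), IsAdmissible A lam' l' →
      subObjective f A lam l ≤ subObjective f A lam' l'

/-- From the set `A`, the iterate `u` and the pruned set `A'` are obtained from some minimizer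
`(lam, l)` of `(𝓟(A))`: `u` is the corresponding combination, and `A'` consists of the elements of
`A` with nonzero weight. -/
def IsUpdate {T : ℝ} (f : L2 T → ℝ) (A : Finset (BV T)) (u : BV T) (A' : Finset (BV T)) : Prop :=
  ∃ (lam : BV T → ℝ) (l : BV T), IsSubMinimizer f A lam l ∧ u = combination A lam l ∧
    ∀ a, a ∈ A' ↔ a ∈ A ∧ lam a ≠ 0

/-- The dual variable `p = ∫_0^· g` (with `g = ∇f(u)`). -/
def dualp {T : ℝ} (g : L2 T) (x : ℝ) : ℝ := ∫ s in (0 : ℝ)..x, g s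

/-- The dual variable `P = -∫_0^· p`. -/
def dualP {T : ℝ} (g : L2 T) (x : ℝ) : ℝ := -∫ s in (0 : ℝ)..x, dualp g s

/-- The uniform norm on `(0, T)`. -/
def supNorm (T : ℝ) (h : ℝ → ℝ) : ℝ := ⨆ x : Ioo (0 : ℝ) T, |h x|

/-- The new extremal point, for `g = ∇f(u_k)` and global extrema `xS` of `|p_k|`, `xK` of `|P_k|`.
Since `(g, S_x) = -p_k(x)` and `(g, K_x) = -P_k(x)`, the signs are those for which the new point
minimizes `(g, ·)` over `Ext B`. -/
def newPoint {T : ℝ} (α β : ℝ) (g : L2 T) (xS xK : Ioo (0 : ℝ) T) : BV T :=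
  if supNorm T (dualP g) / β ≤ supNorm T (dualp g) / α then
    (Real.sign (dualp g xS) / α) • jump xS
  else
    (Real.sign (dualP g xK) / β) • kink xK

open Classical in
/-- The iterates `u k` and active sets `A k`, `k ≥ 1`, are generated by the algorithm from the
initial set `A 0`, and the algorithm never terminates. (The value `u 0` is irrelevant.) -/
structure IsAlgorithmRun {T : ℝ} (α β : ℝ) (f : L2 T → ℝ) (A : ℕ → Finset (BV T)) (u : ℕ → BV T) :
    Prop where
  /-- The initial set is a finite subset of `Ext B`. -/
  initial_subset : ∀ a ∈ A 0, a ∈ extB T α β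
  /-- The initial step: solve `(𝓟(A_0))` and prune. -/
  initial_step : IsUpdate f (A 0) (u 1) (A 1)
  /-- The termination criterion is never met. -/
  not_terminated : ∀ k, 1 ≤ k →
    ¬ (supNorm T (dualp (gradient f (u k : L2 T))) ≤ α ∧
      supNorm T (dualP (gradient f (u k : L2 T))) ≤ β)
  /-- The iteration: choose global extrema of the dual variables, add the new extremal point,
  solve the subproblem for the enlarged set and prune. -/
  step : ∀ k, 1 ≤ k → ∃ xS xK : Ioo (0 : ℝ) T,
    |dualp (gradient f (u k : L2 T)) xS| = supNorm T (dualp (gradient f (u k : L2 T))) ∧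
    |dualP (gradient f (u k : L2 T)) xK| = supNorm T (dualP (gradient f (u k : L2 T))) ∧
    IsUpdate f (insert (newPoint α β (gradient f (u k : L2 T)) xS xK) (A k)) (u (k + 1)) (A (k + 1))

end TGV

end

open scoped Pointwise

noncomputable section

namespace TGV

/-! ### Density of test functions and uniqueness of the distributional derivative -/

lemma norm_C0_le {T : ℝ} (φ : C0 T) {C : ℝ} (hC : 0 ≤ C) (h : ∀ x, |φ x| ≤ C) : ‖φ‖ ≤ C :=
  (BoundedContinuousFunction.norm_le (f := φ.toBCF) hC).2 h

lemma abs_C0_le {T : ℝ} (φ : C0 T) (x : Ioo (0 : ℝ) T) : |φ x| ≤ ‖φ‖ :=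
  φ.toBCF.norm_coe_le_norm x

lemma exists_test_near {T : ℝ} (φ : C0 T) {ε : ℝ} (hε : 0 < ε) :
    ∃ v : 𝓓(Omega T, ℝ), ‖testToC0 v - φ‖ ≤ ε := by
  have hφ : ∀ᶠ x in cocompact (Ioo (0 : ℝ) T), |φ x| < ε := by
    have := φ.zero_at_infty'.abs
    rw [abs_zero] at this
    exact this.eventually_lt_const hε
  obtain ⟨K', hK', hsub⟩ := mem_cocompact.1 hφ
  have hK : IsCompact (Subtype.val '' K' : Set ℝ) := hK'.image continuous_subtype_val
  obtain ⟨L, hL, hKL, hLT⟩ := exists_compact_between hK (isOpen_Ioo (a := (0 : ℝ)) (b := T))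
    (by rintro _ ⟨x, _, rfl⟩; exact x.2)
  obtain ⟨χ, hχ, hχr, hχs, hχ1⟩ := exists_contMDiff_support_eq_eq_one_iff (n := ⊤)
    (modelWithCornersSelf ℝ ℝ) isOpen_interior hK.isClosed hKL
  have hχL : tsupport χ ⊆ L := by
    rw [tsupport, hχs]
    exact closure_minimal interior_subset hL.isClosed
  obtain ⟨g, hg⟩ := ContinuousMap.exists_restrict_eq hL.isClosed
    (⟨fun x : L => φ ⟨x, hLT x.2⟩, by fun_prop⟩ : C(L, ℝ))
  obtain ⟨q, hq⟩ := exists_polynomial_near_of_continuousOn 0 T g g.continuous.continuousOn ε hε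
  have hts : tsupport (fun x => χ x * q.eval x) ⊆ L :=
    (closure_mono (Function.support_mul_subset_left χ fun x => q.eval x)).trans hχL
  have hχ01 : ∀ x, 0 ≤ χ x ∧ χ x ≤ 1 := fun x => hχr ⟨x, rfl⟩
  refine ⟨⟨fun x => χ x * q.eval x, ?_, ?_, hts.trans hLT⟩, norm_C0_le _ hε.le fun x => ?_⟩
  · exact hχ.contDiff.mul (by simpa using q.contDiff_aeval (𝕜 := ℝ) _)
  · exact hL.of_isClosed_subset (isClosed_tsupport _) hts
  change |χ x * q.eval (x : ℝ) - φ x| ≤ ε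
  obtain ⟨h0, h1⟩ := hχ01 x
  by_cases hx : x ∈ K'
  · have hxL : (x : ℝ) ∈ L := interior_subset (hKL ⟨x, hx, rfl⟩)
    have h1 : χ x = 1 := (hχ1 x).1 ⟨x, hx, rfl⟩
    have hgx : g x = φ x := congrArg (fun f : C(L, ℝ) => f ⟨x, hxL⟩) hg
    have := hq x ⟨x.2.1.le, x.2.2.le⟩
    rw [h1, one_mul, ← hgx]
    exact this.le
  · have hφx : |φ x| < ε := hsub hx
    by_cases hxL : (x : ℝ) ∈ L
    · have hgx : g x = φ x := congrArg (fun f : C(L, ℝ) => f ⟨x, hxL⟩) hg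
      have h2 := hq x ⟨x.2.1.le, x.2.2.le⟩
      rw [hgx] at h2
      rw [abs_lt] at h2 hφx
      rw [abs_le]
      constructor <;> nlinarith
    · have : χ x = 0 := image_eq_zero_of_notMem_tsupport fun h => hxL (hχL h)
      rw [this, zero_mul, zero_sub, abs_neg]
      exact hφx.le

lemma denseRange_testToC0 (T : ℝ) : DenseRange (testToC0 (T := T)) := fun φ =>
  Metric.mem_closure_iff.2 fun ε hε => by
    obtain ⟨v, hv⟩ := exists_test_near φ (half_pos hε)
    refine ⟨_, ⟨v, rfl⟩, ?_⟩
    rw [dist_comm, dist_eq_norm]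
    linarith

lemma radon_ext {T : ℝ} {μ ν : Radon T}
    (h : ∀ v : 𝓓(Omega T, ℝ), μ (testToC0 v) = ν (testToC0 v)) : μ = ν :=
  DFunLike.coe_injective <|
    (denseRange_testToC0 T).equalizer μ.continuous ν.continuous (funext h)

lemma isDistribDeriv_D {T : ℝ} (u : BV T) : IsDistribDeriv (u : L2 T) (D u) := u.2.choose_spec

lemma D_eq {T : ℝ} {u : BV T} {μ : Radon T} (h : IsDistribDeriv (u : L2 T) μ) : D u = μ :=
  radon_ext fun v => by rw [isDistribDeriv_D u v, h v]

lemma D_add {T : ℝ} (u w : BV T) : D (u + w) = D u + D w := D_eq fun v => by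
  have : (fun x => ((u + w : BV T) : L2 T) x * deriv v x) =ᵐ[volume.restrict (Ioo 0 T)]
      fun x => (u : L2 T) x * deriv v x + (w : L2 T) x * deriv v x := by
    filter_upwards [Lp.coeFn_add (u : L2 T) (w : L2 T)] with x hx
    rw [Submodule.coe_add, hx, Pi.add_apply, add_mul]
  rw [integral_congr_ae this,
    integral_add (integrable_mul_deriv (u : L2 T) v) (integrable_mul_deriv (w : L2 T) v),
    add_apply, isDistribDeriv_D u v, isDistribDeriv_D w v]
  ring

lemma D_smul {T : ℝ} (c : ℝ) (u : BV T) : D (c • u) = c • D u := D_eq fun v => by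
  have : (fun x => ((c • u : BV T) : L2 T) x * deriv v x) =ᵐ[volume.restrict (Ioo 0 T)]
      fun x => c * ((u : L2 T) x * deriv v x) := by
    filter_upwards [Lp.coeFn_smul c (u : L2 T)] with x hx
    rw [Submodule.coe_smul, hx, Pi.smul_apply, smul_eq_mul, mul_assoc]
  rw [integral_congr_ae this, integral_const_mul, smul_apply, isDistribDeriv_D u v, smul_eq_mul]
  ring

/-- The distributional derivative as a linear map. -/
def DLin (T : ℝ) : BV T →ₗ[ℝ] Radon T where
  toFun := D
  map_add' := D_add
  map_smul' := D_smul

lemma toRadon_apply {T : ℝ} (u : L2 T) (φ : C0 T) {h : ℝ → ℝ} (hφ : ∀ x, φ x = h x) :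
    toRadon u φ = ∫ x in Ioo 0 T, h x * u x := by
  have : toRadon u φ = ∫ x : Ioo (0 : ℝ) T, h x * u x ∂(lebesgue T) := by
    change ∫ x : Ioo (0 : ℝ) T, φ x * u x ∂(lebesgue T) = _
    simp only [hφ]
  rw [this]
  exact integral_subtype_comap (μ := volume) measurableSet_Ioo (fun y => h y * u y)

lemma inner_L2 {T : ℝ} (u w : L2 T) : inner ℝ u w = ∫ x in Ioo 0 T, u x * w x := by
  rw [L2.inner_def]
  refine integral_congr_ae (Eventually.of_forall fun x => ?_)
  simp [mul_comm]

lemma inner_toLp {T : ℝ} (u : L2 T) {h : ℝ → ℝ} (hh : MemLp h 2 (volume.restrict (Ioo 0 T))) :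
    inner ℝ u (hh.toLp h) = ∫ x in Ioo 0 T, u x * h x := by
  rw [inner_L2]
  refine integral_congr_ae ?_
  filter_upwards [hh.coeFn_toLp] with x hx
  rw [hx]

lemma memLp_C0_ext {T : ℝ} (φ : C0 T) :
    MemLp (Function.extend Subtype.val φ 0) 2 (volume.restrict (Ioo 0 T)) := by
  refine MemLp.of_bound ?_ ‖φ‖ ((ae_restrict_iff' measurableSet_Ioo).2
    (Eventually.of_forall fun x hx => ?_))
  · refine ContinuousOn.aestronglyMeasurable ?_ measurableSet_Ioo
    rw [continuousOn_iff_continuous_domRestrict]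
    convert φ.continuous using 1
    ext x
    exact Subtype.val_injective.extend_apply φ 0 x
  · have := Subtype.val_injective.extend_apply φ 0 (⟨x, hx⟩ : Ioo (0 : ℝ) T)
    simp only at this
    rw [this]
    exact abs_C0_le φ _

/-- The inclusion `C₀(0, T) → L²(0, T)`. -/
def C0ToL2 {T : ℝ} (φ : C0 T) : L2 T := (memLp_C0_ext φ).toLp _

lemma toRadon_eq_inner {T : ℝ} (u : L2 T) (φ : C0 T) : toRadon u φ = inner ℝ u (C0ToL2 φ) := by
  rw [C0ToL2, inner_toLp, toRadon_apply u φ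
    (fun x => (Subtype.val_injective.extend_apply φ 0 x).symm)]
  exact integral_congr_ae (Eventually.of_forall fun x => mul_comm _ _)

lemma toRadon_add {T : ℝ} (u w : L2 T) : toRadon (u + w) = toRadon u + toRadon w := by
  ext φ
  simp only [toRadon_eq_inner, inner_add_left, add_apply]

lemma toRadon_smul {T : ℝ} (c : ℝ) (u : L2 T) : toRadon (c • u) = c • toRadon u := by
  ext φ
  simp only [toRadon_eq_inner, inner_smul_left, smul_apply]
  rfl

/-- The embedding `L²(0, T) → M(0, T)` as a linear map. -/
def toRadonLin (T : ℝ) : L2 T →ₗ[ℝ] Radon T where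
  toFun := toRadon
  map_add' := toRadon_add
  map_smul' := toRadon_smul

lemma toRadon_injective (T : ℝ) : Function.Injective (toRadon (T := T)) := by
  refine (injective_iff_map_eq_zero (toRadonLin T)).2 fun u hu => ?_
  rw [Lp.eq_zero_iff_ae_eq_zero]
  have h := isOpen_Ioo.ae_eq_zero_of_integral_contDiff_smul_eq_zero (U := Ioo 0 T)
    (μ := volume.restrict (Ioo 0 T)) (f := u) ((integrable_coe u).locallyIntegrable.locallyIntegrableOn _)
    fun g hg hc hs => by
      have := toRadon_apply u (testToC0 (⟨g, hg, hc, hs⟩ : 𝓓(Omega T, ℝ))) (h := g) fun _ => rfl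
      change (toRadonLin T u) _ = _ at this
      rw [hu] at this
      simpa using this.symm
  filter_upwards [h, ae_restrict_mem measurableSet_Ioo] with x h1 h2
  exact h1 h2

/-! ### Integration by parts against primitives of `L²` functions -/

lemma memLp_of_continuous {T : ℝ} {h : ℝ → ℝ} (hc : Continuous h) :
    MemLp h 2 (volume.restrict (Ioo 0 T)) := by
  obtain ⟨C, hC⟩ := (isCompact_Icc (a := (0 : ℝ)) (b := T)).exists_bound_of_continuousOn
    hc.continuousOn
  exact memLp_of_bound hc.measurable C fun y hy => hC y ⟨hy.1.le, hy.2.le⟩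

lemma exists_norm_toLp_le (T : ℝ) : ∃ K : ℝ, 0 ≤ K ∧ ∀ (h : ℝ → ℝ)
    (hh : MemLp h 2 (volume.restrict (Ioo 0 T))) (C : ℝ), 0 ≤ C → (∀ y ∈ Ioo 0 T, |h y| ≤ C) →
    ‖hh.toLp h‖ ≤ K * C := by
  refine ⟨(volume.restrict (Ioo 0 T)).real univ ^ (2 : ENNReal).toReal⁻¹, by positivity,
    fun h hh C hC hb => ?_⟩
  refine Lp.norm_le_of_ae_bound hC ?_
  filter_upwards [hh.coeFn_toLp, ae_restrict_mem measurableSet_Ioo] with x h1 h2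
  rw [h1]
  exact hb x h2

/-- The derivative of test functions, as a map into `L²(0, T)`. -/
def testDeriv (T : ℝ) : 𝓓(Omega T, ℝ) →ₗ[ℝ] L2 T where
  toFun v := (memLp_of_continuous (test_continuous_deriv v)).toLp (deriv v)
  map_add' v w := by
    rw [← MemLp.toLp_add]
    refine MemLp.toLp_congr _ _ (Eventually.of_forall fun x => ?_)
    exact ((test_hasDerivAt v x).add (test_hasDerivAt w x)).deriv
  map_smul' c v := by
    rw [RingHom.id_apply, ← MemLp.toLp_const_smul]
    refine MemLp.toLp_congr _ _ (Eventually.of_forall fun x => ?_)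
    exact ((test_hasDerivAt v x).const_smul c).deriv

lemma inner_testDeriv {T : ℝ} (u : L2 T) (v : 𝓓(Omega T, ℝ)) :
    inner ℝ u (testDeriv T v) = ∫ x in Ioo 0 T, u x * deriv v x :=
  inner_toLp u (memLp_of_continuous (test_continuous_deriv v))

lemma exists_Icc_of_isCompact {T : ℝ} (hT : 0 < T) {K : Set ℝ} (hK : IsCompact K)
    (hs : K ⊆ Ioo 0 T) : ∃ a b, 0 < a ∧ b < T ∧ K ⊆ Icc a b := by
  rcases K.eq_empty_or_nonempty with rfl | hne
  · exact ⟨T / 2, T / 2, by linarith, by linarith, empty_subset _⟩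
  · obtain ⟨a, ha⟩ := hK.exists_isLeast hne
    obtain ⟨b, hb⟩ := hK.exists_isGreatest hne
    exact ⟨a, b, (hs ha.1).1, (hs hb.1).2, fun x hx => ⟨ha.2 hx, hb.2 hx⟩⟩

lemma exists_test_deriv_eq {T : ℝ} (hT : 0 < T) {η : ℝ → ℝ} (hη : ContDiff ℝ ∞ η)
    (hc : HasCompactSupport η) (hs : tsupport η ⊆ Ioo 0 T) (h0 : ∫ x in (0 : ℝ)..T, η x = 0) :
    ∃ v : 𝓓(Omega T, ℝ), deriv v = η := by
  obtain ⟨a, b, ha, hb, hab⟩ := exists_Icc_of_isCompact hT hc.isCompact hs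
  have hz : ∀ y, y ∉ Icc a b → η y = 0 := fun y hy =>
    image_eq_zero_of_notMem_tsupport fun h => hy (hab h)
  have hd : ∀ x, HasDerivAt (fun x => ∫ y in (0 : ℝ)..x, η y) (η x) x := fun x =>
    intervalIntegral.integral_hasDerivAt_right (hη.continuous.intervalIntegrable _ _)
      (hη.continuous.stronglyMeasurableAtFilter _ _) hη.continuous.continuousAt
  have hder : deriv (fun x => ∫ y in (0 : ℝ)..x, η y) = η := funext fun x => (hd x).deriv
  have hzero : ∀ x, x ∉ Icc a b → ∫ y in (0 : ℝ)..x, η y = 0 := by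
    intro x hx
    have hint : ∀ c, (∀ y ∈ uIoc c x, y ∉ Icc a b) → ∫ y in c..x, η y = 0 := fun c h =>
      intervalIntegral.integral_zero_ae (Eventually.of_forall fun y hy => hz y (h y hy))
    rcases lt_or_ge x a with h | h
    · refine hint 0 fun y hy hy' => ?_
      have : y ≤ max 0 x := hy.2
      exact (max_lt ha h).not_ge (hy'.1.trans this)
    · have hxb : b < x := not_le.1 fun h' => hx ⟨h, h'⟩
      rw [← intervalIntegral.integral_add_adjacent_intervals
        (hη.continuous.intervalIntegrable 0 T) (hη.continuous.intervalIntegrable T x), h0, zero_add]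
      refine hint T fun y hy hy' => ?_
      have : min T x < y := hy.1
      exact (lt_min hb hxb).not_ge (this.le.trans hy'.2)
  have hts : tsupport (fun x => ∫ y in (0 : ℝ)..x, η y) ⊆ Icc a b :=
    closure_minimal (fun x hx => by_contra fun h => hx (hzero x h)) isClosed_Icc
  refine ⟨⟨fun x => ∫ y in (0 : ℝ)..x, η y, ?_, ?_, ?_⟩, hder⟩
  · refine contDiff_infty_iff_deriv.2 ⟨fun x => (hd x).differentiableAt, ?_⟩
    rwa [hder]
  · exact isCompact_Icc.of_isClosed_subset (isClosed_tsupport _) hts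
  · exact hts.trans fun x hx => ⟨ha.trans_le hx.1, hx.2.trans_lt hb⟩

lemma exists_test_integral_one {T : ℝ} (hT : 0 < T) : ∃ ψ : ℝ → ℝ, ContDiff ℝ ∞ ψ ∧
    HasCompactSupport ψ ∧ tsupport ψ ⊆ Ioo 0 T ∧ ∫ x, ψ x = 1 := by
  let φ : ContDiffBump (T / 2) := ⟨T / 8, T / 4, by linarith, by linarith⟩
  refine ⟨φ.normed volume, φ.contDiff_normed, φ.hasCompactSupport_normed, ?_, φ.integral_normed⟩
  rw [φ.tsupport_normed_eq, Real.closedBall_eq_Icc]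
  rintro x ⟨h1, h2⟩
  change T / 2 - T / 4 ≤ x at h1
  change x ≤ T / 2 + T / 4 at h2
  constructor <;> linarith

lemma integral_eq_interval {T : ℝ} (hT : 0 < T) {η : ℝ → ℝ} (hs : tsupport η ⊆ Ioo 0 T) :
    ∫ x, η x = ∫ x in (0 : ℝ)..T, η x := by
  rw [intervalIntegral.integral_of_le hT.le, integral_Ioc_eq_integral_Ioo,
    setIntegral_eq_integral_of_forall_compl_eq_zero fun x hx =>
      image_eq_zero_of_notMem_tsupport fun h => hx (hs h)]

lemma ae_const_of_orthogonal {T : ℝ} (hT : 0 < T) {h : L2 T}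
    (hh : ∀ v, inner ℝ h (testDeriv T v) = 0) :
    ∃ c : ℝ, ∀ᵐ x ∂(volume.restrict (Ioo 0 T)), h x = c := by
  obtain ⟨ψ, hψ, hψc, hψs, hψ1⟩ := exists_test_integral_one hT
  have hint : ∀ φ : ℝ → ℝ, Continuous φ → IntegrableOn (fun x => h x * φ x) (Ioo 0 T) :=
    fun φ hφ => ((memLp_of_continuous hφ).integrable_mul (Lp.memLp h)).congr
      (Eventually.of_forall fun x => mul_comm _ _)
  set c : ℝ := ∫ x in Ioo 0 T, h x * ψ x with hc
  refine ⟨c, ?_⟩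
  have key := isOpen_Ioo.ae_eq_zero_of_integral_contDiff_smul_eq_zero (U := Ioo 0 T)
    (μ := volume.restrict (Ioo 0 T)) (f := fun x => h x - c)
    (((integrable_coe h).sub (integrable_const c)).locallyIntegrable.locallyIntegrableOn _)
    fun φ hφ hφc hφs => by
      set m : ℝ := ∫ x, φ x with hm
      have hsub : tsupport (fun x => φ x - m * ψ x) ⊆ tsupport φ ∪ tsupport ψ := by
        refine closure_minimal (fun x hx => ?_)
          ((isClosed_tsupport _).union (isClosed_tsupport _))
        by_contra hx'
        rw [mem_union, not_or] at hx'
        exact hx (by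
          simp only [image_eq_zero_of_notMem_tsupport hx'.1,
            image_eq_zero_of_notMem_tsupport hx'.2, mul_zero, sub_zero])
      have hsub' := hsub.trans (union_subset hφs hψs)
      obtain ⟨v, hv⟩ := exists_test_deriv_eq hT (η := fun x => φ x - m * ψ x)
        (hφ.sub (contDiff_const.mul hψ))
        ((hφc.isCompact.union hψc.isCompact).of_isClosed_subset (isClosed_tsupport _) hsub)
        hsub' (by
          rw [← integral_eq_interval hT hsub', integral_sub
            (hφ.continuous.integrable_of_hasCompactSupport hφc)
            ((hψ.continuous.integrable_of_hasCompactSupport hψc).const_mul m),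
            integral_const_mul, hψ1, ← hm, mul_one, sub_self])
      have h1 := hh v
      rw [inner_testDeriv, hv] at h1
      have h2 : ∫ x in Ioo 0 T, h x * (φ x - m * ψ x) =
          (∫ x in Ioo 0 T, h x * φ x) - m * c := by
        rw [hc, ← integral_const_mul, ← integral_sub (hint φ hφ.continuous)
          ((hint ψ hψ.continuous).const_mul m)]
        exact integral_congr_ae (Eventually.of_forall fun x => by ring)
      have h3 : ∫ x in Ioo 0 T, φ x • (h x - c) = (∫ x in Ioo 0 T, h x * φ x) - c * m := by
        rw [hm, integral_eq_interval hT hφs, intervalIntegral.integral_of_le hT.le,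
          integral_Ioc_eq_integral_Ioo, ← integral_const_mul, ← integral_sub (hint φ hφ.continuous)
          (((memLp_of_continuous hφ.continuous).integrable (by norm_num)).const_mul c)]
        exact integral_congr_ae (Eventually.of_forall fun x => by
          simp only [smul_eq_mul]; ring)
      rw [h3]
      linarith
  filter_upwards [key, ae_restrict_mem measurableSet_Ioo] with x h1 h2
  linarith [h1 h2]

lemma mem_closure_testDeriv {T : ℝ} (hT : 0 < T) {g : L2 T} (hg : ∫ x in Ioo 0 T, g x = 0) :
    g ∈ closure (range (testDeriv T)) := by
  have : g ∈ (LinearMap.range (testDeriv T))ᗮᗮ := by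
    rw [Submodule.mem_orthogonal]
    intro h hh
    obtain ⟨c, hc⟩ := ae_const_of_orthogonal hT (h := h) fun v =>
      (Submodule.mem_orthogonal' _ _).1 hh _ ⟨v, rfl⟩
    have : (fun x => h x * g x) =ᵐ[volume.restrict (Ioo 0 T)] fun x => c * g x := by
      filter_upwards [hc] with x hx
      rw [hx]
    rw [inner_L2, integral_congr_ae this, integral_const_mul, hg, mul_zero]
  rw [Submodule.orthogonal_orthogonal_eq_closure] at this
  exact this

/-- The characteristic function of `(0, x)` in `L²(0, T)`. -/
def initial (T x : ℝ) : L2 T :=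
  (memLp_of_bound (T := T) (h := (Ioo 0 x).indicator fun _ => 1)
    (measurable_const.indicator measurableSet_Ioo) 1 fun y _ => by
      by_cases hy : y ∈ Ioo 0 x <;> simp [hy]).toLp _

lemma dualp_eq_inner {T : ℝ} (g : L2 T) {x : ℝ} (hx : x ∈ Icc 0 T) :
    dualp g x = inner ℝ g (initial T x) := by
  rw [initial, inner_toLp, dualp, intervalIntegral.integral_of_le hx.1,
    integral_Ioc_eq_integral_Ioo]
  have : (fun y => g y * (Ioo 0 x).indicator (fun _ => 1) y) = (Ioo 0 x).indicator g := by
    ext y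
    by_cases hy : y ∈ Ioo 0 x <;> simp [hy]
  rw [this, integral_indicator measurableSet_Ioo, Measure.restrict_restrict measurableSet_Ioo,
    inter_eq_left.2 (Ioo_subset_Ioo_right hx.2)]

lemma exists_abs_dualp_le (T : ℝ) : ∃ K : ℝ, 0 ≤ K ∧ ∀ (g : L2 T), ∀ x ∈ Icc 0 T,
    |dualp g x| ≤ K * ‖g‖ := by
  obtain ⟨K, hK, h⟩ := exists_norm_toLp_le T
  refine ⟨K, hK, fun g x hx => ?_⟩
  rw [dualp_eq_inner g hx, mul_comm]
  refine (abs_real_inner_le_norm _ _).trans (mul_le_mul_of_nonneg_left ?_ (norm_nonneg _))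
  refine (h _ _ 1 zero_le_one fun y _ => ?_).trans_eq (mul_one K)
  by_cases hy : y ∈ Ioo 0 x <;> simp [hy]

lemma dualp_sub {T : ℝ} (g h : L2 T) {x : ℝ} (hx : x ∈ Icc 0 T) :
    dualp (g - h) x = dualp g x - dualp h x := by
  simp only [dualp_eq_inner _ hx, inner_sub_left]

lemma intervalIntegrable_coe {T : ℝ} (g : L2 T) {a b : ℝ} (ha : a ∈ Icc 0 T) (hb : b ∈ Icc 0 T) :
    IntervalIntegrable g volume a b := by
  have h : IntervalIntegrable g volume 0 T :=
    (intervalIntegrable_iff_integrableOn_Ioo_of_le (ha.1.trans ha.2)).2 (integrable_coe g)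
  exact h.mono_set (by rw [uIcc_of_le (ha.1.trans ha.2)]; exact uIcc_subset_Icc ha hb)

lemma dualp_testDeriv {T : ℝ} (v : 𝓓(Omega T, ℝ)) {x : ℝ} (hx : x ∈ Icc 0 T) :
    dualp (testDeriv T v) x = v x := by
  have h1 : dualp (testDeriv T v) x = ∫ y in (0 : ℝ)..x, deriv v y := by
    rw [dualp, intervalIntegral.integral_of_le hx.1, intervalIntegral.integral_of_le hx.1,
      integral_Ioc_eq_integral_Ioo, integral_Ioc_eq_integral_Ioo]
    refine integral_congr_ae ?_
    exact ae_restrict_of_ae_restrict_of_subset (Ioo_subset_Ioo_right hx.2)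
      (memLp_of_continuous (test_continuous_deriv v)).coeFn_toLp
  rw [h1, intervalIntegral.integral_eq_sub_of_hasDerivAt (fun y _ => test_hasDerivAt v y)
      ((test_continuous_deriv v).intervalIntegrable _ _), test_zero_left, sub_zero]

lemma D_apply_primitive {T : ℝ} (hT : 0 < T) (u : BV T) (g : L2 T) (p : C0 T)
    (hg : ∫ x in Ioo 0 T, g x = 0) (hp : ∀ x, p x = dualp g x) :
    D u p = -inner ℝ (u : L2 T) g := by
  obtain ⟨s, hs, hlim⟩ := mem_closure_iff_seq_limit.1 (mem_closure_testDeriv hT hg)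
  choose v hv using hs
  obtain rfl : (fun n => testDeriv T (v n)) = s := funext hv
  obtain ⟨K, hK, hb⟩ := exists_abs_dualp_le T
  have hC0 : Tendsto (fun n => testToC0 (v n)) atTop (𝓝 p) := by
    rw [tendsto_iff_norm_sub_tendsto_zero]
    have h0 := (tendsto_iff_norm_sub_tendsto_zero.1 hlim).const_mul K
    rw [mul_zero] at h0
    refine squeeze_zero (fun _ => norm_nonneg _) (fun n => ?_) h0
    refine norm_C0_le _ (by positivity) fun x => ?_
    have hx : (x : ℝ) ∈ Icc 0 T := ⟨x.2.1.le, x.2.2.le⟩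
    change |v n x - p x| ≤ _
    rw [hp, ← dualp_testDeriv (v n) hx, ← dualp_sub _ _ hx]
    exact hb _ _ hx
  have h1 := ((D u).continuous.tendsto p).comp hC0
  have h2 := (tendsto_const_nhds (x := (u : L2 T))).inner (𝕜 := ℝ) hlim
  refine tendsto_nhds_unique h1 (h2.neg.congr fun n => ?_)
  rw [Function.comp_apply, isDistribDeriv_D u (v n), inner_testDeriv]

/-- The element of `C₀(0, T)` given by a continuous function on `[0, T]` vanishing at `0`, `T`. -/
def mkC0 {T : ℝ} (h : ℝ → ℝ) (hc : ContinuousOn h (Icc 0 T)) (h0 : h 0 = 0) (hT : h T = 0) :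
    C0 T where
  toFun x := h x
  continuous_toFun := continuousOn_iff_continuous_domRestrict.1 (hc.mono Ioo_subset_Icc_self)
  zero_at_infty' := by
    rw [tendsto_zero_iff_abs_tendsto_zero]
    refine tendsto_order.2 ⟨fun a ha => Eventually.of_forall fun x => ha.trans_le (abs_nonneg _),
      fun ε hε => ?_⟩
    have hK : IsCompact (Icc 0 T ∩ (fun x => |h x|) ⁻¹' Ici ε) :=
      isCompact_Icc.of_isClosed_subset (hc.abs.preimage_isClosed_of_isClosed isClosed_Icc isClosed_Ici)
        inter_subset_left
    have hK' := Topology.IsInducing.subtypeVal.isCompact_preimage' (X := Ioo (0 : ℝ) T) hK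
      (fun x hx => ⟨⟨x, lt_of_le_of_ne hx.1.1 fun e => ?_, lt_of_le_of_ne hx.1.2 fun e => ?_⟩, rfl⟩)
    · filter_upwards [hK'.compl_mem_cocompact] with x hx
      exact not_le.1 fun hle => hx ⟨⟨x.2.1.le, x.2.2.le⟩, hle⟩
    · have : ε ≤ |h x| := hx.2
      rw [← e, h0, abs_zero] at this
      exact hε.not_ge this
    · have : ε ≤ |h x| := hx.2
      rw [e, hT, abs_zero] at this
      exact hε.not_ge this

/-! ### Weak* limits -/

lemma radon_norm_nonneg {T : ℝ} (μ : Radon T) : 0 ≤ ‖μ‖ := μ.opNorm_nonneg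

lemma radon_norm_zero {T : ℝ} : ‖(0 : Radon T)‖ = 0 := ContinuousLinearMap.opNorm_zero

lemma radon_le_norm {T : ℝ} (μ : Radon T) (φ : C0 T) : |μ φ| ≤ ‖μ‖ * ‖φ‖ := μ.le_opNorm φ

lemma radon_sub_zero {T : ℝ} (μ : Radon T) : μ - 0 = μ := by
  ext φ
  rw [sub_apply, zero_apply, sub_zero]

lemma radon_sub_self {T : ℝ} (μ : Radon T) : μ - μ = 0 := by
  ext φ
  rw [sub_apply, zero_apply, sub_self]

lemma radon_norm_smul_le {T : ℝ} (c : ℝ) (μ : Radon T) : ‖c • μ‖ ≤ |c| * ‖μ‖ :=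
  (c • μ).opNorm_le_bound (mul_nonneg (abs_nonneg c) (radon_norm_nonneg μ)) fun φ => by
    rw [smul_apply, smul_eq_mul, norm_mul, mul_assoc]
    exact mul_le_mul_of_nonneg_left (radon_le_norm μ φ) (abs_nonneg c)

lemma radon_norm_sum_le {T : ℝ} {ι : Type*} (A : Finset ι) (μ : ι → Radon T) :
    ‖∑ a ∈ A, μ a‖ ≤ ∑ a ∈ A, ‖μ a‖ := by
  classical
  induction A using Finset.induction_on with
  | empty => simp [radon_norm_zero]
  | insert a s ha ih =>
    rw [Finset.sum_insert ha, Finset.sum_insert ha]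
    exact (ContinuousLinearMap.opNorm_add_le _ _).trans (by gcongr)

lemma exists_ultrafilter_limit {T : ℝ} {ι : Type*} (U : Ultrafilter ι) {u : ι → BV T} {x : L2 T}
    (hu : Tendsto (fun i => (u i : L2 T)) U (𝓝 x)) {R : ℝ} (hR : ∀ᶠ i in U, ‖D (u i)‖ ≤ R) :
    ∃ μ : Radon T, IsDistribDeriv x μ ∧ ∀ φ, Tendsto (fun i => D (u i) φ) U (𝓝 (μ φ)) := by
  obtain ⟨ν, -, hν⟩ := (WeakDual.isCompact_closedBall (𝕜 := ℝ) (0 : Radon T) R).ultrafilter_le_nhds'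
    (U.map fun i => StrongDual.toWeakDual (D (u i)))
    (by
      rw [Ultrafilter.mem_map]
      filter_upwards [hR] with i hi
      change dist (D (u i)) 0 ≤ R
      exact (dist_zero_right (D (u i))).trans_le hi)
  have hlim : ∀ φ, Tendsto (fun i => D (u i) φ) U (𝓝 (WeakDual.toStrongDual ν φ)) := fun φ =>
    ((WeakDual.eval_continuous φ).tendsto ν).comp hν
  refine ⟨WeakDual.toStrongDual ν, fun v => ?_, hlim⟩
  refine tendsto_nhds_unique (hlim (testToC0 v)) ?_
  rw [← inner_testDeriv]
  refine ((hu.inner (𝕜 := ℝ) tendsto_const_nhds).neg).congr fun i => ?_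
  rw [inner_testDeriv, isDistribDeriv_D (u i) v]

lemma exists_BV_limit {T : ℝ} {ι : Type*} {l : Filter ι} [NeBot l] {u : ι → BV T} {x : L2 T}
    (hu : Tendsto (fun i => (u i : L2 T)) l (𝓝 x)) {R : ℝ} (hR : ∀ᶠ i in l, ‖D (u i)‖ ≤ R) :
    ∃ ubar : BV T, (ubar : L2 T) = x ∧ ∀ φ, Tendsto (fun i => D (u i) φ) l (𝓝 (D ubar φ)) := by
  obtain ⟨μ, hμ, -⟩ := exists_ultrafilter_limit (Ultrafilter.of l)
    (hu.mono_left (Ultrafilter.of_le l)) (Ultrafilter.of_le l hR)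
  refine ⟨⟨x, μ, hμ⟩, rfl, fun φ => (tendsto_iff_ultrafilter _ _ _).2 fun U hU => ?_⟩
  obtain ⟨ν, hν, hlim⟩ := exists_ultrafilter_limit U (hu.mono_left hU) (hU hR)
  rw [D_eq (u := ⟨x, μ, hμ⟩) hν]
  exact hlim φ

lemma tendsto_toRadon {T : ℝ} {ι : Type*} {l : Filter ι} {u : ι → L2 T} {x : L2 T}
    (hu : Tendsto u l (𝓝 x)) (φ : C0 T) :
    Tendsto (fun i => toRadon (u i) φ) l (𝓝 (toRadon x φ)) := by
  simp only [toRadon_eq_inner]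
  exact hu.inner tendsto_const_nhds

lemma norm_le_of_tendsto_apply {T : ℝ} {ι : Type*} {l : Filter ι} [NeBot l] {μ : ι → Radon T}
    {ν : Radon T} {a : ℝ} (h : ∀ φ, Tendsto (fun i => μ i φ) l (𝓝 (ν φ)))
    (ha : Tendsto (fun i => ‖μ i‖) l (𝓝 a)) : ‖ν‖ ≤ a :=
  ν.opNorm_le_bound (ge_of_tendsto ha (Eventually.of_forall fun _ => radon_norm_nonneg _)) fun φ =>
    le_of_tendsto_of_tendsto (h φ).norm (ha.mul_const ‖φ‖)
      (Eventually.of_forall fun i => (μ i).le_opNorm φ)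

lemma tendsto_weakStar_iff {T : ℝ} {ι : Type*} {l : Filter ι} {u : ι → BV T} {ubar : BV T} :
    Tendsto u l (@nhds (BV T) (weakStarTopology T) ubar) ↔
      (∀ φ, Tendsto (fun i => toRadon (u i : L2 T) φ) l (𝓝 (toRadon (ubar : L2 T) φ))) ∧
      ∀ φ, Tendsto (fun i => D (u i) φ) l (𝓝 (D ubar φ)) := by
  rw [nhds_induced, tendsto_comap_iff, nhds_prod_eq, tendsto_prod_iff']
  exact and_congr
    (WeakBilin.tendsto_iff_forall_eval_tendsto _ ContinuousLinearMap.coe_injective)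
    (WeakBilin.tendsto_iff_forall_eval_tendsto _ ContinuousLinearMap.coe_injective)

/-! ### The functional `TGV` -/

/-- The functional `α ‖Du - w‖ + β ‖Dw‖` minimized in the definition of `TGV`. -/
def energy {T : ℝ} (α β : ℝ) (u w : BV T) : ℝ :=
  α * ‖D u - toRadon (w : L2 T)‖ + β * ‖D w‖

lemma energy_nonneg {T α β : ℝ} (hα : 0 < α) (hβ : 0 < β) (u w : BV T) : 0 ≤ energy α β u w := by
  unfold energy
  positivity

lemma tgv_le_energy {T α β : ℝ} (hα : 0 < α) (hβ : 0 < β) (u w : BV T) :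
    tgv α β u ≤ energy α β u w :=
  ciInf_le ⟨0, by rintro _ ⟨w, rfl⟩; exact energy_nonneg hα hβ u w⟩ w

lemma tendsto_of_ultrafilter_of_bounded {ι : Type*} (U : Ultrafilter ι) {s : ι → ℝ} {R : ℝ}
    (h0 : ∀ i, 0 ≤ s i) (hR : ∀ᶠ i in U, s i ≤ R) : ∃ a, Tendsto s U (𝓝 a) := by
  obtain ⟨a, -, ha⟩ := (isCompact_Icc (a := 0) (b := R)).ultrafilter_le_nhds' (U.map s)
    (by rw [Ultrafilter.mem_map]; filter_upwards [hR] with i hi using ⟨h0 i, hi⟩)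
  exact ⟨a, ha⟩

lemma tgv_le_of_tendsto {T α β : ℝ} (hα : 0 < α) (hβ : 0 < β) {ι : Type*} (U : Ultrafilter ι)
    {u w : ι → BV T} {Λ : ι → ℝ} {ubar : BV T} {y : L2 T} {L : ℝ}
    (hu : ∀ φ, Tendsto (fun i => D (u i) φ) U (𝓝 (D ubar φ)))
    (hw : Tendsto (fun i => (w i : L2 T)) U (𝓝 y))
    (hΛ : Tendsto Λ U (𝓝 L)) (h : ∀ᶠ i in U, energy α β (u i) (w i) ≤ Λ i) :
    tgv α β ubar ≤ L := by
  have hb : ∀ᶠ i in U, energy α β (u i) (w i) ≤ L + 1 := by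
    filter_upwards [h, hΛ.eventually_lt_const (lt_add_one L)] with i h1 h2 using h1.trans h2.le
  have hb1 : ∀ᶠ i in U, ‖D (u i) - toRadon (w i : L2 T)‖ ≤ (L + 1) / α := by
    filter_upwards [hb] with i hi
    rw [le_div_iff₀ hα, mul_comm]
    refine le_trans ?_ hi
    exact le_add_of_nonneg_right (by positivity)
  have hb2 : ∀ᶠ i in U, ‖D (w i)‖ ≤ (L + 1) / β := by
    filter_upwards [hb] with i hi
    rw [le_div_iff₀ hβ, mul_comm]
    refine le_trans ?_ hi
    exact le_add_of_nonneg_left (by positivity)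
  obtain ⟨a, ha⟩ := tendsto_of_ultrafilter_of_bounded U (fun i => radon_norm_nonneg _) hb1
  obtain ⟨b, hb⟩ := tendsto_of_ultrafilter_of_bounded U (fun i => radon_norm_nonneg _) hb2
  obtain ⟨wbar, rfl, hD⟩ := exists_BV_limit hw hb2
  have h1 : ‖D ubar - toRadon (wbar : L2 T)‖ ≤ a :=
    norm_le_of_tendsto_apply (fun φ => (hu φ).sub (tendsto_toRadon hw φ)) ha
  have h2 : ‖D wbar‖ ≤ b := norm_le_of_tendsto_apply hD hb
  calc tgv α β ubar ≤ energy α β ubar wbar := tgv_le_energy hα hβ _ _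
    _ ≤ α * a + β * b := by unfold energy; gcongr
    _ ≤ L := le_of_tendsto_of_tendsto ((ha.const_mul α).add (hb.const_mul β)) hΛ h

/-! ### Affine functions -/

lemma isDistribDeriv_of_hasDerivAt {T : ℝ} (hT : 0 < T) {h h' : ℝ → ℝ} (hc : Continuous h)
    (hc' : Continuous h') (hd : ∀ x, HasDerivAt h (h' x) x) :
    IsDistribDeriv ((memLp_of_continuous (T := T) hc).toLp h)
      (toRadon ((memLp_of_continuous (T := T) hc').toLp h')) := by
  intro v
  rw [← inner_testDeriv, real_inner_comm, inner_toLp, toRadon_apply _ (testToC0 v) (h := v)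
    fun _ => rfl]
  have e1 : ∫ x in Ioo 0 T, v x * (memLp_of_continuous (T := T) hc').toLp h' x =
      ∫ x in (0 : ℝ)..T, h' x * v x := by
    rw [intervalIntegral.integral_of_le hT.le, integral_Ioc_eq_integral_Ioo]
    refine integral_congr_ae ?_
    filter_upwards [(memLp_of_continuous (T := T) hc').coeFn_toLp] with y hy
    rw [hy, mul_comm]
  have e2 : ∫ x in Ioo 0 T, testDeriv T v x * h x = ∫ x in (0 : ℝ)..T, h x * deriv v x := by
    rw [intervalIntegral.integral_of_le hT.le, integral_Ioc_eq_integral_Ioo]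
    refine integral_congr_ae ?_
    filter_upwards [(memLp_of_continuous (T := T) (test_continuous_deriv v)).coeFn_toLp] with y hy
    change testDeriv T v y = _ at hy
    rw [hy, mul_comm]
  rw [e1, e2, intervalIntegral.integral_mul_deriv_eq_deriv_mul (fun x _ => hd x)
    (fun x _ => test_hasDerivAt v x) (hc'.intervalIntegrable _ _)
    ((test_continuous_deriv v).intervalIntegrable _ _), test_zero_left, test_zero_right]
  ring

lemma continuous_affineFun (c d : ℝ) : Continuous fun x : ℝ => c * x + d := by fun_prop

/-- The affine function `x ↦ c x + d` in `L²(0, T)`. -/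
def affineL2 (T c d : ℝ) : L2 T := (memLp_of_continuous (continuous_affineFun c d)).toLp _

lemma coeFn_affineL2 (T c d : ℝ) :
    affineL2 T c d =ᵐ[volume.restrict (Ioo 0 T)] fun x => c * x + d :=
  (memLp_of_continuous (continuous_affineFun c d)).coeFn_toLp

lemma isDistribDeriv_affine {T : ℝ} (hT : 0 < T) (c d : ℝ) :
    IsDistribDeriv (affineL2 T c d) (toRadon (affineL2 T 0 c)) :=
  isDistribDeriv_of_hasDerivAt hT (continuous_affineFun c d) (continuous_affineFun 0 c) fun x => by
    simpa using ((hasDerivAt_id x).const_mul c).add_const d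

/-- The affine function `x ↦ c x + d` in `BV(0, T)`. -/
def affine {T : ℝ} (hT : 0 < T) (c d : ℝ) : BV T :=
  ⟨affineL2 T c d, _, isDistribDeriv_affine hT c d⟩

lemma affineL2_eq (T c d : ℝ) : affineL2 T c d = c • affineL2 T 1 0 + d • affineL2 T 0 1 := by
  refine Lp.ext ?_
  filter_upwards [coeFn_affineL2 T c d, coeFn_affineL2 T 1 0, coeFn_affineL2 T 0 1,
    Lp.coeFn_add (c • affineL2 T 1 0) (d • affineL2 T 0 1), Lp.coeFn_smul c (affineL2 T 1 0),
    Lp.coeFn_smul d (affineL2 T 0 1)] with x h1 h2 h3 h4 h5 h6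
  rw [h4, Pi.add_apply, h5, h6, Pi.smul_apply, Pi.smul_apply, h1, h2, h3]
  simp

lemma affine_eq {T : ℝ} (hT : 0 < T) (c d : ℝ) :
    affine hT c d = c • affine hT 1 0 + d • affine hT 0 1 :=
  Subtype.ext (affineL2_eq T c d)

lemma D_affine {T : ℝ} (hT : 0 < T) (c d : ℝ) : D (affine hT c d) = toRadon (affine hT 0 c : L2 T) :=
  D_eq (isDistribDeriv_affine hT c d)

lemma D_const {T : ℝ} (hT : 0 < T) (d : ℝ) : D (affine hT 0 d) = 0 := by
  rw [D_affine]
  change toRadon (affineL2 T 0 0) = _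
  rw [affineL2_eq, zero_smul, zero_smul, add_zero]
  exact (toRadonLin T).map_zero

lemma affine_mem {T : ℝ} (hT : 0 < T) (c d : ℝ) : affine hT c d ∈ affineFunctions T :=
  ⟨c, d, coeFn_affineL2 T c d⟩

lemma exists_eq_affine {T : ℝ} (hT : 0 < T) {l : BV T} (hl : l ∈ affineFunctions T) :
    ∃ c d, l = affine hT c d := by
  obtain ⟨c, d, h⟩ := hl
  exact ⟨c, d, Subtype.ext (Lp.ext (EventuallyEq.trans h (coeFn_affineL2 T c d).symm))⟩

lemma add_mem_affineFunctions {T : ℝ} (hT : 0 < T) {l m : BV T} (hl : l ∈ affineFunctions T)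
    (hm : m ∈ affineFunctions T) : l + m ∈ affineFunctions T := by
  obtain ⟨c, d, rfl⟩ := exists_eq_affine hT hl
  obtain ⟨c', d', rfl⟩ := exists_eq_affine hT hm
  have : affine hT c d + affine hT c' d' = affine hT (c + c') (d + d') := by
    rw [affine_eq hT c, affine_eq hT c', affine_eq hT (c + c')]
    module
  exact this ▸ affine_mem hT _ _

lemma smul_mem_affineFunctions {T : ℝ} (hT : 0 < T) (t : ℝ) {l : BV T}
    (hl : l ∈ affineFunctions T) : t • l ∈ affineFunctions T := by
  obtain ⟨c, d, rfl⟩ := exists_eq_affine hT hl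
  have : t • affine hT c d = affine hT (t * c) (t * d) := by
    rw [affine_eq hT c, affine_eq hT (t * c)]
    module
  exact this ▸ affine_mem hT _ _

/-! ### Jumps and kinks -/

lemma D_jump {T : ℝ} (x : Ioo (0 : ℝ) T) : D (jump x) = dirac x := D_eq (isDistribDeriv_jump x)

/-- The derivative of the kink `K_x`, as an element of `BV(0, T)`. -/
def kinkD {T : ℝ} (hT : 0 < T) (x : Ioo (0 : ℝ) T) : BV T :=
  if (x : ℝ) < T / 2 then jump x + affine hT 0 (-1) else jump x

lemma D_kinkD {T : ℝ} (hT : 0 < T) (x : Ioo (0 : ℝ) T) : D (kinkD hT x) = dirac x := by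
  unfold kinkD
  split_ifs
  · rw [D_add, D_const, D_jump, add_zero]
  · exact D_jump x

lemma D_kink {T : ℝ} (hT : 0 < T) (x : Ioo (0 : ℝ) T) :
    D (kink x) = toRadon (kinkD hT x : L2 T) := by
  rw [D_eq (u := kink x) (isDistribDeriv_kink x)]
  congr 1
  refine Lp.ext ?_
  have hne : ∀ᵐ y ∂(volume.restrict (Ioo 0 T)), y ≠ (x : ℝ) :=
    ae_restrict_of_ae (Measure.ae_ne (μ := volume) (x : ℝ))
  unfold kinkD
  split_ifs with h
  · filter_upwards [(memLp_kinkDeriv T x).coeFn_toLp, coeFn_affineL2 T 0 (-1),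
      (memLp_jumpFun T x).coeFn_toLp, Lp.coeFn_add (jump x : L2 T) (affineL2 T 0 (-1)), hne,
      ae_restrict_mem measurableSet_Ioo] with y h1 h2 h3 h4 h5 h6
    change (jump x : L2 T) y = _ at h3
    change _ = ((jump x : L2 T) + affineL2 T 0 (-1)) y
    rw [h1, h4, Pi.add_apply, h2, h3, kinkDeriv, if_pos h, jumpFun]
    by_cases hy : y < x
    · rw [if_pos hy, indicator_of_notMem fun h' => hy.not_gt h'.1]; ring
    · rw [if_neg hy, indicator_of_mem (show y ∈ Ioo (x : ℝ) T from ⟨lt_of_le_of_ne (not_lt.1 hy) h5.symm, h6.2⟩)]; ring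
  · filter_upwards [(memLp_kinkDeriv T x).coeFn_toLp, (memLp_jumpFun T x).coeFn_toLp, hne,
      ae_restrict_mem measurableSet_Ioo] with y h1 h3 h5 h6
    change (jump x : L2 T) y = _ at h3
    rw [h1, h3, kinkDeriv, if_neg h, jumpFun]
    by_cases hy : y < x
    · rw [if_pos hy, indicator_of_notMem fun h' => hy.not_gt h'.1]
    · rw [if_neg hy, indicator_of_mem (show y ∈ Ioo (x : ℝ) T from ⟨lt_of_le_of_ne (not_lt.1 hy) h5.symm, h6.2⟩)]

lemma norm_dirac_le {T : ℝ} (x : Ioo (0 : ℝ) T) : ‖dirac x‖ ≤ 1 :=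
  LinearMap.mkContinuous_norm_le _ zero_le_one _

/-- `a` is a multiple (by a factor in `[-1, 1]`) of a normalized jump or kink, and `a'` is the
minimizer `w` in the definition of `TGV(a)`. -/
def IsAtom {T : ℝ} (hT : 0 < T) (α β : ℝ) (a a' : BV T) : Prop :=
  ∃ (σ : ℝ) (x : Ioo (0 : ℝ) T), |σ| ≤ 1 ∧
    ((a = (σ / α) • jump x ∧ a' = 0) ∨ (a = (σ / β) • kink x ∧ a' = (σ / β) • kinkD hT x))

lemma IsAtom.energy_le {T : ℝ} {hT : 0 < T} {α β : ℝ} (hα : 0 < α) (hβ : 0 < β) {a a' : BV T}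
    (h : IsAtom hT α β a a') : energy α β a a' ≤ 1 := by
  have key : ∀ (γ σ : ℝ) (x : Ioo (0 : ℝ) T), 0 < γ → |σ| ≤ 1 →
      γ * ‖(σ / γ) • dirac x‖ ≤ 1 := by
    intro γ σ x hγ hσ
    calc γ * ‖(σ / γ) • dirac x‖ ≤ γ * (|σ / γ| * ‖dirac x‖) := by
          gcongr; exact radon_norm_smul_le _ _
      _ = |σ| * ‖dirac x‖ := by
          rw [abs_div, abs_of_pos hγ, ← mul_assoc, mul_div_cancel₀ _ hγ.ne']
      _ ≤ 1 := mul_le_one₀ hσ (radon_norm_nonneg _) (norm_dirac_le x)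
  obtain ⟨σ, x, hσ, ⟨rfl, rfl⟩ | ⟨rfl, rfl⟩⟩ := h
  · have h0 : toRadon ((0 : BV T) : L2 T) = 0 := (toRadonLin T).map_zero
    have h1 : D (0 : BV T) = 0 := (DLin T).map_zero
    rw [energy, h0, h1, radon_norm_zero, mul_zero, add_zero, radon_sub_zero, D_smul, D_jump]
    exact key α σ x hα hσ
  · rw [energy, D_smul, D_smul, D_kink hT, D_kinkD, Submodule.coe_smul, toRadon_smul,
      radon_sub_self, radon_norm_zero, mul_zero, zero_add]
    exact key β σ x hβ hσ

lemma exists_isAtom {T : ℝ} (hT : 0 < T) {α β : ℝ} {a : BV T} (ha : a ∈ extB T α β) :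
    ∃ a', IsAtom hT α β a a' := by
  have habs : ∀ σ : ℝ, σ = 1 ∨ σ = -1 → |σ| ≤ 1 := by rintro σ (rfl | rfl) <;> simp
  obtain ⟨σ, x, hσ, rfl⟩ | ⟨σ, x, hσ, -, rfl⟩ := ha
  · exact ⟨_, σ, x, habs σ hσ, .inl ⟨rfl, rfl⟩⟩
  · exact ⟨_, σ, x, habs σ hσ, .inr ⟨rfl, rfl⟩⟩

lemma exists_isAtom_newPoint {T : ℝ} (hT : 0 < T) (α β : ℝ) (g : L2 T) (xS xK : Ioo (0 : ℝ) T) :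
    ∃ a', IsAtom hT α β (newPoint α β g xS xK) a' := by
  have habs : ∀ r : ℝ, |Real.sign r| ≤ 1 := fun r => by
    rcases Real.sign_apply_eq r with h | h | h <;> simp [h]
  unfold newPoint
  split_ifs
  · exact ⟨_, _, xS, habs _, .inl ⟨rfl, rfl⟩⟩
  · exact ⟨_, _, xK, habs _, .inr ⟨rfl, rfl⟩⟩

lemma energy_combination_le {T α β : ℝ} (hT : 0 < T) (hα : 0 < α) (hβ : 0 < β) (A : Finset (BV T))
    (lam : BV T → ℝ) (hlam : ∀ a ∈ A, 0 ≤ lam a) (W : BV T → BV T)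
    (hW : ∀ a ∈ A, energy α β a (W a) ≤ 1) (c d : ℝ) :
    energy α β (combination A lam (affine hT c d)) (∑ a ∈ A, lam a • W a + affine hT 0 c) ≤
      ∑ a ∈ A, lam a := by
  have hsum : ∀ V : BV T → BV T, D (∑ a ∈ A, lam a • V a) = ∑ a ∈ A, lam a • D (V a) := fun V =>
    (map_sum (DLin T) _ A).trans (Finset.sum_congr rfl fun a _ => D_smul _ _)
  have hsum' : toRadon ((∑ a ∈ A, lam a • W a : BV T) : L2 T) =
      ∑ a ∈ A, lam a • toRadon (W a : L2 T) :=
    (map_sum (toRadonLin T ∘ₗ (BV T).subtype) _ A).trans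
      (Finset.sum_congr rfl fun a _ => toRadon_smul _ _)
  have h1 : D (combination A lam (affine hT c d)) -
      toRadon ((∑ a ∈ A, lam a • W a + affine hT 0 c : BV T) : L2 T) =
      ∑ a ∈ A, lam a • (D a - toRadon (W a : L2 T)) := by
    rw [combination, D_add, hsum, Submodule.coe_add, toRadon_add, hsum', D_affine]
    ext φ
    simp only [sub_apply, add_apply, sum_apply, smul_apply, smul_sub,
      Finset.sum_sub_distrib]
    abel
  have h2 : D (∑ a ∈ A, lam a • W a + affine hT 0 c) = ∑ a ∈ A, lam a • D (W a) := by
    rw [D_add, D_const, add_zero, hsum]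
  have hn : ∀ (μ : BV T → Radon T), ‖∑ a ∈ A, lam a • μ a‖ ≤ ∑ a ∈ A, lam a * ‖μ a‖ := fun μ =>
    (radon_norm_sum_le A _).trans (Finset.sum_le_sum fun a ha => by
      have := radon_norm_smul_le (lam a) (μ a)
      rwa [abs_of_nonneg (hlam a ha)] at this)
  calc _ ≤ α * ∑ a ∈ A, lam a * ‖D a - toRadon (W a : L2 T)‖ +
        β * ∑ a ∈ A, lam a * ‖D (W a)‖ := by
        rw [energy, h1, h2]
        gcongr <;> exact hn _
    _ = ∑ a ∈ A, lam a * energy α β a (W a) := by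
        rw [Finset.mul_sum, Finset.mul_sum, ← Finset.sum_add_distrib]
        refine Finset.sum_congr rfl fun a ha => ?_
        rw [energy]
        ring
    _ ≤ ∑ a ∈ A, lam a := Finset.sum_le_sum fun a ha =>
        mul_le_of_le_one_right (hlam a ha) (hW a ha)

/-! ### Compactness of combinations of atoms -/

lemma continuous_toLp_family {T : ℝ} {X : Type*} [TopologicalSpace X] [FirstCountableTopology X]
    (F : X → ℝ → ℝ) (hm : ∀ x, Measurable (F x)) (C : ℝ) (hC : ∀ x, ∀ y ∈ Ioo 0 T, |F x y| ≤ C)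
    (hcont : ∀ x, ∀ᵐ y ∂(volume.restrict (Ioo 0 T)), ContinuousAt (fun z => F z y) x) :
    Continuous fun x => (memLp_of_bound (hm x) C (hC x)).toLp (F x) := by
  refine continuous_iff_continuousAt.2 fun x₀ => ?_
  rw [ContinuousAt, tendsto_iff_norm_sub_tendsto_zero]
  have hsq : ∀ x, ‖(memLp_of_bound (hm x) C (hC x)).toLp (F x) -
      (memLp_of_bound (hm x₀) C (hC x₀)).toLp (F x₀)‖ =
      √(∫ y in Ioo 0 T, (F x y - F x₀ y) ^ 2) := fun x => by
    rw [← MemLp.toLp_sub, norm_eq_sqrt_real_inner, inner_toLp]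
    congr 1
    refine integral_congr_ae ?_
    filter_upwards [((memLp_of_bound (hm x) C (hC x)).sub
      (memLp_of_bound (hm x₀) C (hC x₀))).coeFn_toLp] with y hy
    rw [hy, Pi.sub_apply, sq]
  simp only [hsq]
  have h0 : Tendsto (fun x => ∫ y in Ioo 0 T, (F x y - F x₀ y) ^ 2) (𝓝 x₀)
      (𝓝 (∫ y in Ioo 0 T, (0 : ℝ))) := by
    refine tendsto_integral_filter_of_dominated_convergence (fun _ => (2 * C) ^ 2)
      (Eventually.of_forall fun x => (((hm x).sub (hm x₀)).pow_const 2).aestronglyMeasurable)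
      (Eventually.of_forall fun x => ?_) (integrable_const _) ?_
    · filter_upwards [ae_restrict_mem measurableSet_Ioo] with y hy
      rw [Real.norm_eq_abs, abs_pow]
      have h1 := hC x y hy
      have h2 := hC x₀ y hy
      have h3 := abs_sub (F x y) (F x₀ y)
      gcongr
      linarith
    · filter_upwards [hcont x₀] with y hy
      have : Tendsto (fun z => (F z y - F x₀ y) ^ 2) (𝓝 x₀) (𝓝 ((F x₀ y - F x₀ y) ^ 2)) :=
        (hy.tendsto.sub_const _).pow 2
      simpa using this
  rw [integral_zero] at h0
  simpa using h0.sqrt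

lemma exists_continuous_jump (T : ℝ) : ∃ S : Icc (0 : ℝ) T → L2 T, Continuous S ∧
    ∀ x : Ioo (0 : ℝ) T, (jump x : L2 T) = S ⟨x, x.2.1.le, x.2.2.le⟩ := by
  refine ⟨_, continuous_toLp_family (X := Icc (0 : ℝ) T) (fun x => jumpFun T x)
    (fun x => measurable_const.indicator measurableSet_Ioo) 1 (fun x y _ => ?_) (fun x => ?_),
    fun x => rfl⟩
  · by_cases hy : y ∈ Ioo (x : ℝ) T <;> simp [jumpFun, hy]
  · filter_upwards [ae_restrict_of_ae (Measure.ae_ne (μ := volume) (x : ℝ)),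
      ae_restrict_mem measurableSet_Ioo] with y hy hyT
    rcases lt_or_gt_of_ne hy with h | h
    · have : ∀ᶠ z : Icc (0 : ℝ) T in 𝓝 x, jumpFun T z y = 0 := by
        filter_upwards [continuous_subtype_val.continuousAt.eventually (lt_mem_nhds h)] with z hz
        exact indicator_of_notMem (fun h' => hz.not_gt h'.1) _
      exact (continuousAt_const (y := (0 : ℝ))).congr (this.mono fun z hz => hz.symm)
    · have : ∀ᶠ z : Icc (0 : ℝ) T in 𝓝 x, jumpFun T z y = 1 := by
        filter_upwards [continuous_subtype_val.continuousAt.eventually (gt_mem_nhds h)] with z hz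
        exact indicator_of_mem (show y ∈ Ioo (z : ℝ) T from ⟨hz, hyT.2⟩) _
      exact (continuousAt_const (y := (1 : ℝ))).congr (this.mono fun z hz => hz.symm)

lemma exists_continuous_kink (T : ℝ) : ∃ L R : Icc (0 : ℝ) T → L2 T, Continuous L ∧ Continuous R ∧
    ∀ x : Ioo (0 : ℝ) T, (kink x : L2 T) =
      if (x : ℝ) < T / 2 then L ⟨x, x.2.1.le, x.2.2.le⟩ else R ⟨x, x.2.1.le, x.2.2.le⟩ := by
  refine ⟨_, _, continuous_toLp_family (X := Icc (0 : ℝ) T) (fun x y => max (x - y) 0)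
    (fun x => by fun_prop) T (fun x y hy => ?_) (fun x => Eventually.of_forall fun y => by fun_prop),
    continuous_toLp_family (X := Icc (0 : ℝ) T) (fun x y => max (y - x) 0)
    (fun x => by fun_prop) T (fun x y hy => ?_) (fun x => Eventually.of_forall fun y => by fun_prop),
    fun x => ?_⟩
  · have h1 := x.2.1
    have h2 := x.2.2
    rw [abs_of_nonneg (le_max_right _ _)]
    exact max_le (by linarith [hy.1]) (by linarith)
  · have h1 := x.2.1
    have h2 := x.2.2
    rw [abs_of_nonneg (le_max_right _ _)]
    exact max_le (by linarith [hy.2]) (by linarith)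
  · have : ∀ y, kinkFun T x y = if (x : ℝ) < T / 2 then max (x - y) 0 else max (y - x) 0 :=
      fun y => rfl
    split_ifs with h
    · exact MemLp.toLp_congr (memLp_kinkFun x) _ (Eventually.of_forall fun y => by rw [this y, if_pos h])
    · exact MemLp.toLp_congr (memLp_kinkFun x) _ (Eventually.of_forall fun y => by rw [this y, if_neg h])

lemma exists_compact_isAtom {T : ℝ} (hT : 0 < T) (α β : ℝ) : ∃ K : Set (L2 T × L2 T),
    IsCompact K ∧ ∀ a a', IsAtom hT α β a a' → ((a : L2 T), (a' : L2 T)) ∈ K := by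
  obtain ⟨S, hS, hSj⟩ := exists_continuous_jump T
  obtain ⟨L, R, hL, hR, hLR⟩ := exists_continuous_kink T
  let F₁ : Icc (-1 : ℝ) 1 × Icc (0 : ℝ) T → L2 T × L2 T := fun z => (((z.1 : ℝ) / α) • S z.2, 0)
  let F₂ : Icc (-1 : ℝ) 1 × Icc (0 : ℝ) T → L2 T × L2 T := fun z =>
    (((z.1 : ℝ) / β) • L z.2, ((z.1 : ℝ) / β) • (S z.2 + affineL2 T 0 (-1)))
  let F₃ : Icc (-1 : ℝ) 1 × Icc (0 : ℝ) T → L2 T × L2 T := fun z => (((z.1 : ℝ) / β) • R z.2, ((z.1 : ℝ) / β) • S z.2)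
  have h₁ : Continuous F₁ := by fun_prop
  have h₂ : Continuous F₂ := by fun_prop
  have h₃ : Continuous F₃ := by fun_prop
  refine ⟨range F₁ ∪ (range F₂ ∪ range F₃), (isCompact_range h₁).union
    ((isCompact_range h₂).union (isCompact_range h₃)), ?_⟩
  rintro a a' ⟨σ, x, hσ, ⟨rfl, rfl⟩ | ⟨rfl, rfl⟩⟩
  · exact .inl ⟨(⟨σ, abs_le.1 hσ⟩, ⟨x, x.2.1.le, x.2.2.le⟩), Prod.ext (by
      rw [Submodule.coe_smul, hSj]) rfl⟩
  · by_cases h : (x : ℝ) < T / 2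
    · refine .inr (.inl ⟨(⟨σ, abs_le.1 hσ⟩, ⟨x, x.2.1.le, x.2.2.le⟩), Prod.ext ?_ ?_⟩)
      · rw [Submodule.coe_smul, hLR, if_pos h]
      · change _ = ((σ / β) • kinkD hT x : BV T).1
        rw [kinkD, if_pos h]
        change _ = (σ / β) • ((jump x : L2 T) + affineL2 T 0 (-1))
        rw [hSj]
    · refine .inr (.inr ⟨(⟨σ, abs_le.1 hσ⟩, ⟨x, x.2.1.le, x.2.2.le⟩), Prod.ext ?_ ?_⟩)
      · rw [Submodule.coe_smul, hLR, if_neg h]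
      · change _ = ((σ / β) • kinkD hT x : BV T).1
        rw [kinkD, if_neg h]
        change _ = (σ / β) • (jump x : L2 T)
        rw [hSj]

lemma exists_compact_conic_sum {E : Type*} [NormedAddCommGroup E] [NormedSpace ℝ E] [CompleteSpace E]
    {K : Set E} (hK : IsCompact K) (M : ℝ) : ∃ K' : Set E, IsCompact K' ∧
      ∀ {ι : Type} (A : Finset ι) (lam : ι → ℝ) (z : ι → E), (∀ a ∈ A, 0 ≤ lam a) →
        (∀ a ∈ A, z a ∈ K) → ∑ a ∈ A, lam a ≤ M → ∑ a ∈ A, lam a • z a ∈ K' := by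
  have hconv : IsCompact (closure (convexHull ℝ K)) :=
    isCompact_iff_totallyBounded_isComplete.2
      ⟨hK.totallyBounded.convexHull.closure, isClosed_closure.isComplete⟩
  refine ⟨insert 0 ((fun q : ℝ × E => q.1 • q.2) '' (Icc 0 M ×ˢ closure (convexHull ℝ K))),
    ((isCompact_Icc.prod hconv).image (by fun_prop)).insert 0, fun A lam z h0 hz hM => ?_⟩
  rcases (Finset.sum_nonneg h0).eq_or_lt with h | h
  · left
    have := (Finset.sum_eq_zero_iff_of_nonneg h0).1 h.symm
    exact Finset.sum_eq_zero fun a ha => by rw [this a ha, zero_smul]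
  · right
    refine ⟨(∑ a ∈ A, lam a, A.centerMass lam z), ⟨⟨h.le, hM⟩, subset_closure
      (Finset.centerMass_mem_convexHull A h0 h hz)⟩, ?_⟩
    change (∑ a ∈ A, lam a) • A.centerMass lam z = _
    rw [Finset.centerMass, smul_smul, mul_inv_cancel₀ h.ne', one_smul]

lemma dualp_affineL2 {T : ℝ} (c d : ℝ) {x : ℝ} (hx : x ∈ Icc 0 T) :
    dualp (affineL2 T c d) x = c * x ^ 2 / 2 + d * x := by
  have h1 : dualp (affineL2 T c d) x = ∫ y in (0 : ℝ)..x, (c * y + d) := by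
    rw [dualp, intervalIntegral.integral_of_le hx.1, intervalIntegral.integral_of_le hx.1,
      integral_Ioc_eq_integral_Ioo, integral_Ioc_eq_integral_Ioo]
    exact integral_congr_ae (ae_restrict_of_ae_restrict_of_subset (Ioo_subset_Ioo_right hx.2)
      (coeFn_affineL2 T c d))
  rw [h1, intervalIntegral.integral_add
      (Continuous.intervalIntegrable (by fun_prop) _ _) (Continuous.intervalIntegrable (by fun_prop) _ _),
    intervalIntegral.integral_const_mul, integral_id, intervalIntegral.integral_const, smul_eq_mul]
  ring

lemma abs_dualp_le_integral {T : ℝ} (g : L2 T) {x : ℝ} (hx : x ∈ Icc 0 T) :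
    |dualp g x| ≤ ∫ y in Ioo 0 T, |g y| := by
  rw [dualp, intervalIntegral.integral_of_le hx.1, integral_Ioc_eq_integral_Ioo]
  refine (abs_integral_le_integral_abs).trans ?_
  exact setIntegral_mono_set (integrable_coe g).abs (Eventually.of_forall fun y => abs_nonneg _)
    (Ioo_subset_Ioo_right hx.2).eventuallyLE

lemma exists_compact_combination {T : ℝ} (hT : 0 < T) (α β M R : ℝ) : ∃ K : Set (L2 T × L2 T),
    IsCompact K ∧ ∀ (A : Finset (BV T)) (lam : BV T → ℝ) (W : BV T → BV T) (c d : ℝ),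
      (∀ a ∈ A, 0 ≤ lam a) → (∀ a ∈ A, IsAtom hT α β a (W a)) → ∑ a ∈ A, lam a ≤ M →
      ∫ x in Ioo 0 T, |(combination A lam (affine hT c d) : L2 T) x| ≤ R →
      ((combination A lam (affine hT c d) : L2 T),
        ((∑ a ∈ A, lam a • W a + affine hT 0 c : BV T) : L2 T)) ∈ K := by
  obtain ⟨K₀, hK₀, hatom⟩ := exists_compact_isAtom hT α β
  obtain ⟨K₁, hK₁, hsum⟩ := exists_compact_conic_sum hK₀ M
  obtain ⟨r, hr⟩ := hK₁.isBounded.exists_norm_le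
  obtain ⟨C, hC, hdual⟩ := exists_abs_dualp_le T
  set B : ℝ := R + C * r with hB
  have hcont : Continuous fun q : ℝ × ℝ => (affineL2 T q.1 q.2, affineL2 T 0 q.1) := by
    have : (fun q : ℝ × ℝ => (affineL2 T q.1 q.2, affineL2 T 0 q.1)) = fun q =>
        (q.1 • affineL2 T 1 0 + q.2 • affineL2 T 0 1,
          (0 : ℝ) • affineL2 T 1 0 + q.1 • affineL2 T 0 1) := by
      ext1 q
      rw [affineL2_eq T q.1 q.2, affineL2_eq T 0 q.1]
    rw [this]
    fun_prop
  refine ⟨K₁ + (fun q : ℝ × ℝ => (affineL2 T q.1 q.2, affineL2 T 0 q.1)) ''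
    (Icc (-(12 * B / T ^ 2)) (12 * B / T ^ 2) ×ˢ Icc (-(7 * B / T)) (7 * B / T)),
    hK₁.add ((isCompact_Icc.prod isCompact_Icc).image hcont), fun A lam W c d h0 hW hM hR => ?_⟩
  have hs := hsum A lam (fun a => ((a : L2 T), (W a : L2 T))) h0 (fun a ha => hatom _ _ (hW a ha)) hM
  refine Set.mem_add.2 ⟨_, hs, (affineL2 T c d, affineL2 T 0 c), ⟨(c, d), ?_, rfl⟩, ?_⟩
  · have hu : (combination A lam (affine hT c d) : L2 T) =
        ∑ a ∈ A, lam a • (a : L2 T) + affineL2 T c d := by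
      rw [combination, Submodule.coe_add]
      congr 1
      exact map_sum (BV T).subtype _ A
    have hns : ‖∑ a ∈ A, lam a • (a : L2 T)‖ ≤ r := by
      refine le_trans ?_ ((norm_fst_le _).trans (hr _ hs))
      rw [Prod.fst_sum]
      rfl
    have hbound : ∀ x ∈ Icc 0 T, |c * x ^ 2 / 2 + d * x| ≤ B := fun x hx => by
      have e : affineL2 T c d = (combination A lam (affine hT c d) : L2 T) -
          ∑ a ∈ A, lam a • (a : L2 T) := by rw [hu, add_sub_cancel_left]
      rw [← dualp_affineL2 c d hx, e, dualp_sub _ _ hx]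
      refine (abs_sub _ _).trans (add_le_add ((abs_dualp_le_integral _ hx).trans hR) ?_)
      exact (hdual _ x hx).trans (by gcongr)
    have b1 := abs_le.1 (hbound T ⟨hT.le, le_rfl⟩)
    have b2 := abs_le.1 (hbound (T / 2) ⟨by linarith, by linarith⟩)
    have hc : |c| ≤ 12 * B / T ^ 2 := by
      rw [le_div_iff₀ (by positivity), ← abs_of_pos (show 0 < T ^ 2 by positivity), ← abs_mul,
        abs_le]
      constructor <;> nlinarith
    have hd : |d| ≤ 7 * B / T := by
      rw [le_div_iff₀ hT, ← abs_of_pos hT, ← abs_mul, abs_le]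
      constructor <;> nlinarith
    exact ⟨abs_le.1 hc, abs_le.1 hd⟩
  · refine Prod.ext ?_ ?_
    · rw [Prod.fst_add, Prod.fst_sum, combination, Submodule.coe_add]
      congr 1
      exact (map_sum (BV T).subtype (fun a => lam a • a) A).symm
    · rw [Prod.snd_add, Prod.snd_sum, Submodule.coe_add]
      congr 1
      exact (map_sum (BV T).subtype (fun a => lam a • W a) A).symm

/-! ### The dual variables -/

lemma continuousOn_dualp {T : ℝ} (hT : 0 < T) (g : L2 T) : ContinuousOn (dualp g) (Icc 0 T) := by
  have h := intervalIntegrable_coe g (left_mem_Icc.2 hT.le) (right_mem_Icc.2 hT.le)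
  have := intervalIntegral.continuousOn_primitive_interval (μ := volume) (f := g) (a := 0) (b := T) (by
    rw [uIcc_of_le hT.le]
    exact (intervalIntegrable_iff_integrableOn_Icc_of_le hT.le).1 h)
  rwa [uIcc_of_le hT.le] at this

lemma integral_sub_mul_eq {T : ℝ} (g : L2 T) {x : ℝ} (hx : x ∈ Icc 0 T) :
    ∫ y in (0 : ℝ)..x, g y * (x - y) = -dualP g x := by
  have hg : IntervalIntegrable g volume 0 x :=
    intervalIntegrable_coe g (left_mem_Icc.2 (hx.1.trans hx.2)) hx
  have hac := hg.absolutelyContinuousOnInterval_intervalIntegral (c := 0) (by simp)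
  have haf : AbsolutelyContinuousOnInterval (fun y => x - y) 0 x :=
    (show ContDiff ℝ 1 fun y => x - y by fun_prop).contDiffOn.absolutelyContinuousOnInterval
  have key := haf.integral_mul_deriv_eq_deriv_mul hac
  have e1 : ∫ y in (0 : ℝ)..x, (x - y) * deriv (fun z => ∫ t in (0 : ℝ)..z, g t) y =
      ∫ y in (0 : ℝ)..x, g y * (x - y) := by
    refine intervalIntegral.integral_congr_ae ?_
    filter_upwards [hg.ae_hasDerivAt_integral] with y hy hy'
    rw [(hy (uIoc_subset_uIcc hy') 0 (by simp)).deriv, mul_comm]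
  have e2 : ∀ y : ℝ, deriv (fun y => x - y) y = -1 := fun y => by
    simp
  rw [e1] at key
  rw [key]
  simp only [e2, sub_self, zero_mul, intervalIntegral.integral_same, mul_zero, neg_one_mul,
    intervalIntegral.integral_neg, dualP, dualp, sub_zero, zero_sub]

lemma inner_max_sub {T : ℝ} (g : L2 T) {x : ℝ} (hx : x ∈ Icc 0 T)
    (hm : MemLp (fun y => max (x - y) 0) 2 (volume.restrict (Ioo 0 T))) :
    inner ℝ g (hm.toLp _) = -dualP g x := by
  rw [inner_toLp, ← integral_sub_mul_eq g hx, intervalIntegral.integral_of_le hx.1,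
    integral_Ioc_eq_integral_Ioo]
  have h1 : ∫ y in Ioo 0 x, g y * (x - y) = ∫ y in Ioo 0 x, g y * max (x - y) 0 :=
    setIntegral_congr_fun measurableSet_Ioo fun y hy => by
      simp only [max_eq_left (sub_nonneg.2 hy.2.le)]
  rw [h1]
  refine (setIntegral_eq_of_subset_of_forall_sdiff_eq_zero measurableSet_Ioo
    (Ioo_subset_Ioo_right hx.2) fun y hy => ?_)
  have : x ≤ y := not_lt.1 fun h => hy.2 ⟨hy.1.1, h⟩
  rw [max_eq_right (sub_nonpos.2 this), mul_zero]

/-- `g` is orthogonal to all affine functions. -/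
def IsOrthAffine {T : ℝ} (g : L2 T) : Prop := ∀ c d, inner ℝ g (affineL2 T c d) = 0

lemma IsOrthAffine.integral_eq_zero {T : ℝ} {g : L2 T} (hg : IsOrthAffine g) :
    ∫ x in Ioo 0 T, g x = 0 := by
  have := hg 0 1
  rw [affineL2, inner_toLp] at this
  simpa using this

lemma IsOrthAffine.dualp_right {T : ℝ} (hT : 0 < T) {g : L2 T} (hg : IsOrthAffine g) :
    dualp g T = 0 := by
  rw [dualp, intervalIntegral.integral_of_le hT.le, integral_Ioc_eq_integral_Ioo,
    hg.integral_eq_zero]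

lemma IsOrthAffine.dualP_right {T : ℝ} (hT : 0 < T) {g : L2 T} (hg : IsOrthAffine g) :
    dualP g T = 0 := by
  have := hg (-1) T
  rw [affineL2, inner_toLp] at this
  rw [← neg_eq_zero, ← integral_sub_mul_eq g (right_mem_Icc.2 hT.le),
    intervalIntegral.integral_of_le hT.le, integral_Ioc_eq_integral_Ioo]
  refine Eq.trans ?_ this
  exact integral_congr_ae (Eventually.of_forall fun y => by ring)

lemma IsOrthAffine.inner_jump {T : ℝ} {g : L2 T} (hg : IsOrthAffine g) (x : Ioo (0 : ℝ) T) :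
    inner ℝ g (jump x : L2 T) = -dualp g x := by
  have hT : 0 < T := x.2.1.trans x.2.2
  have hx : (x : ℝ) ∈ Icc 0 T := ⟨x.2.1.le, x.2.2.le⟩
  have h1 : inner ℝ g (jump x : L2 T) = ∫ y in (x : ℝ)..T, g y := by
    rw [jump, inner_toLp, intervalIntegral.integral_of_le hx.2, integral_Ioc_eq_integral_Ioo]
    have : (fun y => g y * jumpFun T x y) = (Ioo (x : ℝ) T).indicator g := by
      ext y
      by_cases hy : y ∈ Ioo (x : ℝ) T <;> simp [jumpFun, hy]
    rw [this, integral_indicator measurableSet_Ioo, Measure.restrict_restrict measurableSet_Ioo,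
      inter_eq_left.2 (Ioo_subset_Ioo_left hx.1)]
  have h2 := intervalIntegral.integral_add_adjacent_intervals
    (intervalIntegrable_coe g (left_mem_Icc.2 hT.le) hx)
    (intervalIntegrable_coe g hx (right_mem_Icc.2 hT.le))
  have h3 := hg.dualp_right hT
  rw [dualp] at h3 ⊢
  rw [h1]
  linarith

lemma IsOrthAffine.inner_kink {T : ℝ} {g : L2 T} (hg : IsOrthAffine g) (x : Ioo (0 : ℝ) T) :
    inner ℝ g (kink x : L2 T) = -dualP g x := by
  have hx : (x : ℝ) ∈ Icc 0 T := ⟨x.2.1.le, x.2.2.le⟩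
  have hm : MemLp (fun y => max ((x : ℝ) - y) 0) 2 (volume.restrict (Ioo 0 T)) :=
    memLp_of_continuous (by fun_prop)
  by_cases h : (x : ℝ) < T / 2
  · have : (kink x : L2 T) = hm.toLp _ := MemLp.toLp_congr (memLp_kinkFun x) hm
      (Eventually.of_forall fun y => by rw [kinkFun, if_pos h])
    rw [this, inner_max_sub g hx]
  · have : (kink x : L2 T) = hm.toLp _ + affineL2 T 1 (-x) := by
      rw [affineL2, ← MemLp.toLp_add]
      refine MemLp.toLp_congr (memLp_kinkFun x) _ (Eventually.of_forall fun y => ?_)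
      rw [kinkFun, if_neg h, Pi.add_apply]
      rcases le_total y (x : ℝ) with h' | h'
      · rw [max_eq_left (sub_nonneg.2 h'), max_eq_right (sub_nonpos.2 h')]; ring
      · rw [max_eq_right (sub_nonpos.2 h'), max_eq_left (sub_nonneg.2 h')]; ring
    rw [this, inner_add_right, hg, add_zero, inner_max_sub g hx]

lemma IsOrthAffine.inner_newPoint {T : ℝ} {g : L2 T} (hg : IsOrthAffine g) {α β : ℝ}
    {xS xK : Ioo (0 : ℝ) T} (hS : |dualp g xS| = supNorm T (dualp g))
    (hK : |dualP g xK| = supNorm T (dualP g)) :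
    inner ℝ g (newPoint α β g xS xK : L2 T) =
      -max (supNorm T (dualp g) / α) (supNorm T (dualP g) / β) := by
  have hsign : ∀ r : ℝ, Real.sign r * r = |r| := fun r => by
    rcases lt_trichotomy r 0 with h | h | h
    · rw [Real.sign_of_neg h, abs_of_neg h]; ring
    · simp [h]
    · rw [Real.sign_of_pos h, abs_of_pos h, one_mul]
  unfold newPoint
  split_ifs with h
  · rw [max_eq_left h, Submodule.coe_smul, inner_smul_right, hg.inner_jump, ← hS, ← hsign]
    ring
  · rw [max_eq_right (not_le.1 h).le, Submodule.coe_smul, inner_smul_right, hg.inner_kink, ← hK,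
      ← hsign]
    ring

lemma continuousOn_dualP {T : ℝ} (hT : 0 < T) (g : L2 T) : ContinuousOn (dualP g) (Icc 0 T) := by
  have := intervalIntegral.continuousOn_primitive_interval (μ := volume) (f := dualp g)
    (a := 0) (b := T) (by
      rw [uIcc_of_le hT.le]
      exact (continuousOn_dualp hT g).integrableOn_Icc)
  rw [uIcc_of_le hT.le] at this
  exact this.neg

lemma abs_le_supNorm {T : ℝ} {h : ℝ → ℝ} (hc : ContinuousOn h (Icc 0 T)) (x : Ioo (0 : ℝ) T) :
    |h x| ≤ supNorm T h := by
  obtain ⟨C, hC⟩ := (isCompact_Icc (a := (0 : ℝ)) (b := T)).exists_bound_of_continuousOn hc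
  exact le_ciSup (f := fun x : Ioo (0 : ℝ) T => |h x|)
    ⟨C, by rintro _ ⟨y, rfl⟩; exact hC y ⟨y.2.1.le, y.2.2.le⟩⟩ x

lemma IsOrthAffine.neg_inner_le_tgv {T : ℝ} (hT : 0 < T) {g : L2 T} (hg : IsOrthAffine g) {α β : ℝ}
    (hα : 0 < α) (hβ : 0 < β) (hp : ∀ x ∈ Ioo 0 T, |dualp g x| ≤ α)
    (hP : ∀ x ∈ Ioo 0 T, |dualP g x| ≤ β) (v : BV T) :
    -inner ℝ g (v : L2 T) ≤ tgv α β v := by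
  have hmem : MemLp (fun x => -dualp g x) 2 (volume.restrict (Ioo 0 T)) :=
    MemLp.of_bound (((continuousOn_dualp hT g).mono Ioo_subset_Icc_self).neg.aestronglyMeasurable
      measurableSet_Ioo) α ((ae_restrict_iff' measurableSet_Ioo).2
      (Eventually.of_forall fun x hx => by rw [Real.norm_eq_abs, abs_neg]; exact hp x hx))
  let p : C0 T := mkC0 (dualp g) (continuousOn_dualp hT g) (by simp [dualp]) (hg.dualp_right hT)
  let P : C0 T := mkC0 (dualP g) (continuousOn_dualP hT g) (by simp [dualP]) (hg.dualP_right hT)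
  have hPprim : ∀ x ∈ Icc 0 T, dualP g x = dualp (hmem.toLp _) x := fun x hx => by
    rw [dualP, ← intervalIntegral.integral_neg, dualp, intervalIntegral.integral_of_le hx.1,
      intervalIntegral.integral_of_le hx.1, integral_Ioc_eq_integral_Ioo,
      integral_Ioc_eq_integral_Ioo]
    exact (integral_congr_ae (ae_restrict_of_ae_restrict_of_subset (Ioo_subset_Ioo_right hx.2)
      hmem.coeFn_toLp)).symm
  have hmean : ∫ x in Ioo 0 T, hmem.toLp _ x = 0 := by
    have := hPprim T (right_mem_Icc.2 hT.le)
    rwa [hg.dualP_right hT, dualp, intervalIntegral.integral_of_le hT.le,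
      integral_Ioc_eq_integral_Ioo, eq_comm] at this
  have hpn : ‖p‖ ≤ α := norm_C0_le p hα.le fun x => hp x x.2
  have hPn : ‖P‖ ≤ β := norm_C0_le P hβ.le fun x => hP x x.2
  refine le_ciInf fun w => ?_
  have h1 : D v p = -inner ℝ (v : L2 T) g :=
    D_apply_primitive hT v g p hg.integral_eq_zero fun x => rfl
  have h2 : D w P = -inner ℝ (w : L2 T) (hmem.toLp _) :=
    D_apply_primitive hT w _ P hmean fun x => hPprim x ⟨x.2.1.le, x.2.2.le⟩
  have h3 : toRadon (w : L2 T) p = D w P := by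
    rw [h2, inner_toLp, toRadon_apply _ p (h := dualp g) fun x => rfl, ← integral_neg]
    exact integral_congr_ae (Eventually.of_forall fun x => by ring)
  have h4 : -inner ℝ g (v : L2 T) = (D v - toRadon (w : L2 T)) p + D w P := by
    rw [sub_apply, h1, h3, real_inner_comm]
    ring
  rw [h4]
  have h5 := (le_abs_self _).trans (radon_le_norm (D v - toRadon (w : L2 T)) p)
  have h6 := (le_abs_self _).trans (radon_le_norm (D w) P)
  have h7 := mul_le_mul_of_nonneg_left hpn (radon_norm_nonneg (D v - toRadon (w : L2 T)))
  have h8 := mul_le_mul_of_nonneg_left hPn (radon_norm_nonneg (D w))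
  linarith

/-! ### Descent and optimality -/

section Descent

variable {H : Type*} [NormedAddCommGroup H] [InnerProductSpace ℝ H] [CompleteSpace H] {f : H → ℝ}

lemma hasDerivAt_line (hf : Differentiable ℝ f) (u v : H) (t : ℝ) :
    HasDerivAt (fun s : ℝ => f (u + s • v)) (inner ℝ (gradient f (u + t • v)) v) t := by
  have h1 : HasDerivAt (fun s : ℝ => u + s • v) v t := by
    simpa using ((hasDerivAt_id t).smul_const v).const_add u
  have h2 := (hf (u + t • v)).hasFDerivAt.comp_hasDerivAt t h1
  rwa [← inner_gradient_left] at h2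

lemma le_of_lipschitz_gradient (hf : Differentiable ℝ f) {L : ℝ}
    (hL : ∀ u₁ u₂ : H, ‖gradient f u₁ - gradient f u₂‖ ≤ L * ‖u₁ - u₂‖) (hL0 : 0 ≤ L)
    (u v : H) {t : ℝ} (ht : 0 ≤ t) :
    f (u + t • v) ≤ f u + t * inner ℝ (gradient f u) v + L * t ^ 2 * ‖v‖ ^ 2 := by
  rcases ht.eq_or_lt with rfl | ht
  · simp
  obtain ⟨s, hs, hslope⟩ := exists_hasDerivAt_eq_slope (fun s : ℝ => f (u + s • v))
    (fun s => inner ℝ (gradient f (u + s • v)) v) ht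
    (fun s _ => (hasDerivAt_line hf u v s).continuousAt.continuousWithinAt)
    (fun s _ => hasDerivAt_line hf u v s)
  rw [zero_smul, add_zero, sub_zero, eq_div_iff ht.ne'] at hslope
  have h1 : inner ℝ (gradient f (u + s • v)) v ≤ inner ℝ (gradient f u) v + L * t * ‖v‖ ^ 2 := by
    have h2 : inner ℝ (gradient f (u + s • v)) v - inner ℝ (gradient f u) v ≤
        ‖gradient f (u + s • v) - gradient f u‖ * ‖v‖ := by
      rw [← inner_sub_left]
      exact real_inner_le_norm _ _
    have h3 := hL (u + s • v) u
    rw [add_sub_cancel_left, norm_smul, Real.norm_of_nonneg hs.1.le] at h3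
    have h4 : ‖gradient f (u + s • v) - gradient f u‖ * ‖v‖ ≤ L * (t * ‖v‖) * ‖v‖ := by
      refine mul_le_mul_of_nonneg_right (h3.trans ?_) (norm_nonneg _)
      have := hs.2.le
      gcongr
    linarith [show L * (t * ‖v‖) * ‖v‖ = L * t * ‖v‖ ^ 2 by ring]
  have h5 := mul_le_mul_of_nonneg_right h1 ht.le
  linarith [show (inner ℝ (gradient f u) v + L * t * ‖v‖ ^ 2) * t =
    t * inner ℝ (gradient f u) v + L * t ^ 2 * ‖v‖ ^ 2 by ring]

end Descent

lemma tendsto_one_of_descent {j m : ℕ → ℝ} {M C : ℝ} (hM : 0 < M) (hm : ∀ n, 1 ≤ m n)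
    (hj : ∀ n, C ≤ j n)
    (hd : ∀ n t, 0 ≤ t → j (n + 1) ≤ j n + t * (1 - m n) + M * t ^ 2) :
    Tendsto m atTop (𝓝 1) := by
  have hanti : Antitone j := antitone_nat_of_succ_le fun n => by simpa using hd n 0 le_rfl
  have hlim := tendsto_atTop_ciInf hanti ⟨C, by rintro _ ⟨n, rfl⟩; exact hj n⟩
  have hdiff : Tendsto (fun n => 4 * M * (j n - j (n + 1))) atTop (𝓝 0) := by
    simpa using (hlim.sub (hlim.comp (tendsto_add_atTop_nat 1))).const_mul (4 * M)
  have hsq : ∀ n, (m n - 1) ^ 2 ≤ 4 * M * (j n - j (n + 1)) := fun n => by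
    have h := hd n ((m n - 1) / (2 * M)) (div_nonneg (sub_nonneg.2 (hm n)) (by positivity))
    have e : (m n - 1) / (2 * M) * (1 - m n) + M * ((m n - 1) / (2 * M)) ^ 2 =
        -((m n - 1) ^ 2 / (4 * M)) := by
      field_simp
      ring
    have h' : (m n - 1) ^ 2 / (4 * M) ≤ j n - j (n + 1) := by linarith
    rwa [div_le_iff₀ (by positivity), mul_comm] at h'
  have h0 : Tendsto (fun n => √((m n - 1) ^ 2)) atTop (𝓝 0) := by
    simpa using (squeeze_zero (fun n => sq_nonneg _) hsq hdiff).sqrt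
  have h1 : Tendsto (fun n => m n - 1) atTop (𝓝 0) :=
    h0.congr fun n => Real.sqrt_sq (sub_nonneg.2 (hm n))
  simpa using h1.add_const 1

lemma combination_add_right {T : ℝ} (A : Finset (BV T)) (lam : BV T → ℝ) (l m : BV T) :
    combination A lam (l + m) = combination A lam l + m := (add_assoc _ _ _).symm

lemma combination_scale {T : ℝ} (A : Finset (BV T)) (lam : BV T → ℝ) (l : BV T) (s : ℝ) :
    combination A (fun a => s * lam a) (s • l) = s • combination A lam l := by
  simp only [combination, smul_add, Finset.smul_sum, mul_smul]

lemma IsSubMinimizer.isOrthAffine {T : ℝ} (hT : 0 < T) {f : L2 T → ℝ} (hf : Differentiable ℝ f)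
    {A : Finset (BV T)} {lam : BV T → ℝ} {l : BV T} (h : IsSubMinimizer f A lam l) :
    IsOrthAffine (gradient f (combination A lam l : L2 T)) := by
  intro c d
  have hd := hasDerivAt_line hf (combination A lam l : L2 T) (affineL2 T c d) 0
  rw [zero_smul, add_zero] at hd
  refine IsLocalMin.hasDerivAt_eq_zero (Eventually.of_forall fun t => ?_) hd
  have := h.2 lam (l + t • affine hT c d) ⟨h.1.1, add_mem_affineFunctions hT h.1.2
    (smul_mem_affineFunctions hT t (affine_mem hT c d))⟩
  rw [subObjective, subObjective, combination_add_right, add_le_add_iff_right] at this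
  simp only [zero_smul, add_zero]
  exact this

lemma IsSubMinimizer.sum_eq {T : ℝ} (hT : 0 < T) {f : L2 T → ℝ} (hf : Differentiable ℝ f)
    {A : Finset (BV T)} {lam : BV T → ℝ} {l : BV T} (h : IsSubMinimizer f A lam l) :
    ∑ a ∈ A, lam a =
      -inner ℝ (gradient f (combination A lam l : L2 T)) (combination A lam l : L2 T) := by
  set u := combination A lam l with hu
  have hd := (hasDerivAt_line hf (u : L2 T) (u : L2 T) 0).add
    (((hasDerivAt_id (0 : ℝ)).const_add 1).mul_const (∑ a ∈ A, lam a))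
  rw [zero_smul, add_zero, one_mul] at hd
  have hmin : inner ℝ (gradient f (u : L2 T)) (u : L2 T) + ∑ a ∈ A, lam a = 0 := by
    refine IsLocalMin.hasDerivAt_eq_zero ?_ hd
    filter_upwards [lt_mem_nhds (show (-1 : ℝ) < 0 by norm_num)] with t ht
    have := h.2 (fun a => (1 + t) * lam a) ((1 + t) • l)
      ⟨fun a ha => mul_nonneg (by linarith) (h.1.1 a ha), smul_mem_affineFunctions hT _ h.1.2⟩
    rw [subObjective, subObjective, combination_scale, ← hu, add_smul, one_smul,
      ← Finset.mul_sum] at this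
    simp only [Pi.add_apply, zero_smul, add_zero, id, one_mul]
    exact this
  linarith

/-- The value of the subproblem at its solution `u`. -/
def subValue {T : ℝ} (f : L2 T → ℝ) (u : L2 T) : ℝ := f u - inner ℝ (gradient f u) u

lemma IsUpdate.facts {T : ℝ} (hT : 0 < T) {f : L2 T → ℝ} (hf : Differentiable ℝ f)
    {B A : Finset (BV T)} {u : BV T} (h : IsUpdate f B u A) :
    A ⊆ B ∧ IsOrthAffine (gradient f (u : L2 T)) ∧
    (∃ (lam : BV T → ℝ) (c d : ℝ), (∀ a ∈ A, 0 ≤ lam a) ∧ u = combination A lam (affine hT c d) ∧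
      ∑ a ∈ A, lam a = -inner ℝ (gradient f (u : L2 T)) (u : L2 T)) ∧
    ∀ lam l, IsAdmissible B lam l → subValue f (u : L2 T) ≤ subObjective f B lam l := by
  obtain ⟨lam, l, hmin, rfl, hA⟩ := h
  have hAB : A ⊆ B := fun a ha => ((hA a).1 ha).1
  have hzero : ∀ a ∈ B, a ∉ A → lam a = 0 := fun a ha ha' => by
    by_contra hne
    exact ha' ((hA a).2 ⟨ha, hne⟩)
  obtain ⟨c, d, rfl⟩ := exists_eq_affine hT hmin.1.2
  refine ⟨hAB, hmin.isOrthAffine hT hf, ⟨lam, c, d, fun a ha => hmin.1.1 a (hAB ha), ?_, ?_⟩,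
    fun lam' l' h' => ?_⟩
  · rw [combination, combination]
    congr 1
    exact (Finset.sum_subset hAB fun a ha ha' => by rw [hzero a ha ha', zero_smul]).symm
  · rw [← hmin.sum_eq hT hf]
    exact Finset.sum_subset hAB hzero
  · rw [subValue, sub_eq_add_neg, ← hmin.sum_eq hT hf]
    exact hmin.2 lam' l' h'

open Classical in
lemma exists_combination_insert {T : ℝ} (hT : 0 < T) (f : L2 T → ℝ) (A : Finset (BV T))
    (lam : BV T → ℝ) (h0 : ∀ a ∈ A, 0 ≤ lam a) (c d : ℝ) (a₀ : BV T) {t : ℝ} (ht : 0 ≤ t) :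
    ∃ lam' l', IsAdmissible (insert a₀ A) lam' l' ∧ subObjective f (insert a₀ A) lam' l' =
      f ((combination A lam (affine hT c d) : L2 T) + t • (a₀ : L2 T)) + (∑ a ∈ A, lam a + t) := by
  have hin : insert a₀ A ∩ A = A := Finset.inter_eq_right.2 (Finset.subset_insert _ _)
  refine ⟨fun a => (if a ∈ A then lam a else 0) + if a = a₀ then t else 0, affine hT c d,
    ⟨fun a _ => add_nonneg ?_ ?_, affine_mem hT c d⟩, ?_⟩
  · split_ifs with h
    exacts [h0 a h, le_rfl]
  · split_ifs
    exacts [ht, le_rfl]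
  · have h1 : ∑ a ∈ insert a₀ A, ((if a ∈ A then lam a else 0) + if a = a₀ then t else 0) =
        ∑ a ∈ A, lam a + t := by
      rw [Finset.sum_add_distrib, Finset.sum_ite_mem, hin, Finset.sum_ite_eq',
        if_pos (Finset.mem_insert_self _ _)]
    have h2 : ∑ a ∈ insert a₀ A, ((if a ∈ A then lam a else 0) + if a = a₀ then t else 0) • a =
        ∑ a ∈ A, lam a • a + t • a₀ := by
      simp only [add_smul, ite_smul, zero_smul]
      rw [Finset.sum_add_distrib, Finset.sum_ite_mem, hin, Finset.sum_ite_eq',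
        if_pos (Finset.mem_insert_self _ _)]
    rw [subObjective, combination, h1, h2, combination, add_right_comm]
    rfl

/-! ### Properties of the iterates -/

lemma exists_norm_atom_le {T : ℝ} (hT : 0 < T) (α β : ℝ) : ∃ r : ℝ,
    ∀ a a' : BV T, IsAtom hT α β a a' → ‖(a : L2 T)‖ ≤ r := by
  obtain ⟨K, hK, h⟩ := exists_compact_isAtom hT α β
  obtain ⟨r, hr⟩ := hK.isBounded.exists_norm_le
  exact ⟨r, fun a a' ha => (norm_fst_le _).trans (hr _ (h a a' ha))⟩

section Run

variable {T α β : ℝ} {f : L2 T → ℝ} {A : ℕ → Finset (BV T)} {u : ℕ → BV T}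

lemma IsAlgorithmRun.exists_isAtom (hT : 0 < T) (hf : Differentiable ℝ f)
    (hrun : IsAlgorithmRun α β f A u) (k : ℕ) : ∀ a ∈ A k, ∃ a', IsAtom hT α β a a' := by
  classical
  induction k with
  | zero => exact fun a ha => TGV.exists_isAtom hT (hrun.initial_subset a ha)
  | succ k ih =>
    rcases Nat.eq_zero_or_pos k with rfl | hk
    · exact fun a ha => ih a ((hrun.initial_step.facts hT hf).1 ha)
    · obtain ⟨xS, xK, -, -, hup⟩ := hrun.step k hk
      intro a ha
      rcases Finset.mem_insert.1 ((hup.facts hT hf).1 ha) with rfl | h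
      · exact exists_isAtom_newPoint hT α β _ xS xK
      · exact ih a h

lemma IsAlgorithmRun.facts (hT : 0 < T) (hf : Differentiable ℝ f)
    (hrun : IsAlgorithmRun α β f A u) {k : ℕ} (hk : 1 ≤ k) :
    IsOrthAffine (gradient f (u k : L2 T)) ∧
    ∃ (lam : BV T → ℝ) (c d : ℝ), (∀ a ∈ A k, 0 ≤ lam a) ∧
      u k = combination (A k) lam (affine hT c d) ∧
      ∑ a ∈ A k, lam a = -inner ℝ (gradient f (u k : L2 T)) (u k : L2 T) := by
  obtain rfl | hk' := hk.eq_or_lt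
  · have h := hrun.initial_step.facts hT hf
    exact ⟨h.2.1, h.2.2.1⟩
  · obtain ⟨n, rfl⟩ : ∃ n, k = n + 1 := ⟨k - 1, by omega⟩
    obtain ⟨xS, xK, -, -, hup⟩ := hrun.step n (by omega)
    have h := hup.facts hT hf
    exact ⟨h.2.1, h.2.2.1⟩

/-- The violation `max (‖p‖ / α) (‖P‖ / β)` of the termination criterion. -/
def violation {T : ℝ} (α β : ℝ) (g : L2 T) : ℝ :=
  max (supNorm T (dualp g) / α) (supNorm T (dualP g) / β)

lemma IsAlgorithmRun.descent (hT : 0 < T) (hf : Differentiable ℝ f) {L : ℝ} (hL0 : 0 ≤ L)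
    (hL : ∀ u₁ u₂ : L2 T, ‖gradient f u₁ - gradient f u₂‖ ≤ L * ‖u₁ - u₂‖)
    {r : ℝ} (hr : ∀ a a' : BV T, IsAtom hT α β a a' → ‖(a : L2 T)‖ ≤ r)
    (hrun : IsAlgorithmRun α β f A u) {k : ℕ} (hk : 1 ≤ k) {t : ℝ} (ht : 0 ≤ t) :
    subValue f (u (k + 1) : L2 T) ≤ subValue f (u k : L2 T) +
      t * (1 - violation α β (gradient f (u k : L2 T))) + L * r ^ 2 * t ^ 2 := by
  classical
  obtain ⟨hort, lam, c, d, h0, huk, hsum⟩ := hrun.facts hT hf hk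
  obtain ⟨xS, xK, hS, hK, hup⟩ := hrun.step k hk
  set a₀ := newPoint α β (gradient f (u k : L2 T)) xS xK
  obtain ⟨lam', l', hadm, hobj⟩ := exists_combination_insert hT f (A k) lam h0 c d a₀ ht
  have h1 := (hup.facts hT hf).2.2.2 lam' l' hadm
  rw [hobj, ← huk, hsum] at h1
  have h2 := le_of_lipschitz_gradient hf hL hL0 (u k : L2 T) (a₀ : L2 T) ht
  rw [hort.inner_newPoint hS hK] at h2
  obtain ⟨a', ha'⟩ := exists_isAtom_newPoint hT α β (gradient f (u k : L2 T)) xS xK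
  have h3 : ‖(a₀ : L2 T)‖ ^ 2 ≤ r ^ 2 := by
    have := hr _ _ ha'
    gcongr
  have h4 : L * t ^ 2 * ‖(a₀ : L2 T)‖ ^ 2 ≤ L * t ^ 2 * r ^ 2 := by gcongr
  simp only [subValue, violation] at h1 ⊢
  linarith

lemma IsAlgorithmRun.one_le_violation (hα : 0 < α) (hβ : 0 < β)
    (hrun : IsAlgorithmRun α β f A u) {k : ℕ} (hk : 1 ≤ k) :
    1 ≤ violation α β (gradient f (u k : L2 T)) := by
  by_contra! h
  rw [violation, max_lt_iff, div_lt_one hα, div_lt_one hβ] at h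
  exact hrun.not_terminated k hk ⟨h.1.le, h.2.le⟩

lemma IsAlgorithmRun.neg_inner_nonneg (hT : 0 < T) (hf : Differentiable ℝ f)
    (hrun : IsAlgorithmRun α β f A u) {k : ℕ} (hk : 1 ≤ k) :
    0 ≤ -inner ℝ (gradient f (u k : L2 T)) (u k : L2 T) := by
  obtain ⟨-, lam, c, d, h0, -, hsum⟩ := hrun.facts hT hf hk
  exact hsum ▸ Finset.sum_nonneg h0

lemma IsAlgorithmRun.tendsto_violation (hT : 0 < T) (hα : 0 < α) (hβ : 0 < β)
    (hf : Differentiable ℝ f) {L : ℝ} (hL0 : 0 ≤ L)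
    (hL : ∀ u₁ u₂ : L2 T, ‖gradient f u₁ - gradient f u₂‖ ≤ L * ‖u₁ - u₂‖)
    {C : ℝ} (hC : ∀ u : L2 T, C ≤ f u) (hrun : IsAlgorithmRun α β f A u) :
    Tendsto (fun k => violation α β (gradient f (u k : L2 T))) atTop (𝓝 1) := by
  obtain ⟨r, hr⟩ := exists_norm_atom_le hT α β
  rw [← tendsto_add_atTop_iff_nat 1]
  refine tendsto_one_of_descent (j := fun n => subValue f (u (n + 1) : L2 T))
    (M := L * r ^ 2 + 1) (C := C) (by positivity)
    (fun n => hrun.one_le_violation hα hβ (by omega)) (fun n => ?_) (fun n t ht => ?_)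
  · have h1 := hC (u (n + 1) : L2 T)
    have h2 := hrun.neg_inner_nonneg hT hf (k := n + 1) (by omega)
    rw [subValue]
    linarith
  · have h1 := hrun.descent hT hf hL0 hL hr (k := n + 1) (by omega) ht
    nlinarith [sq_nonneg t]

lemma IsAlgorithmRun.subValue_le (hT : 0 < T) (hf : Differentiable ℝ f) {L : ℝ} (hL0 : 0 ≤ L)
    (hL : ∀ u₁ u₂ : L2 T, ‖gradient f u₁ - gradient f u₂‖ ≤ L * ‖u₁ - u₂‖)
    (hrun : IsAlgorithmRun α β f A u) {k : ℕ} (hk : 1 ≤ k) :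
    subValue f (u k : L2 T) ≤ subValue f (u 1 : L2 T) := by
  obtain ⟨r, hr⟩ := exists_norm_atom_le hT α β
  induction k, hk using Nat.le_induction with
  | base => exact le_rfl
  | succ k hk ih =>
    have := hrun.descent hT hf hL0 hL hr hk (t := 0) le_rfl
    simp only [zero_mul, add_zero, ne_eq, OfNat.ofNat_ne_zero, not_false_eq_true, zero_pow,
      mul_zero] at this
    exact this.trans ih

lemma IsAlgorithmRun.exists_compact (hT : 0 < T) (hα : 0 < α) (hβ : 0 < β)
    (hf : Differentiable ℝ f) {L : ℝ} (hL0 : 0 ≤ L)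
    (hL : ∀ u₁ u₂ : L2 T, ‖gradient f u₁ - gradient f u₂‖ ≤ L * ‖u₁ - u₂‖)
    {C : ℝ} (hC : ∀ u : L2 T, C ≤ f u)
    (hA4 : ∀ c : ℝ, ∃ R : ℝ, ∀ u : BV T, J α β f u ≤ c → bvNorm u ≤ R)
    (hrun : IsAlgorithmRun α β f A u) :
    ∃ (K : Set (L2 T × L2 T)) (R : ℝ) (w : ℕ → BV T), IsCompact K ∧ ∀ k, 1 ≤ k →
      ((u k : L2 T), (w k : L2 T)) ∈ K ∧ ‖D (u k)‖ ≤ R ∧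
      energy α β (u k) (w k) ≤ -inner ℝ (gradient f (u k : L2 T)) (u k : L2 T) := by
  obtain ⟨R, hR⟩ := hA4 (subValue f (u 1 : L2 T))
  obtain ⟨K, hK, hmem⟩ := exists_compact_combination hT α β (subValue f (u 1 : L2 T) - C) R
  suffices H : ∀ k, 1 ≤ k → ∃ w : BV T, ((u k : L2 T), (w : L2 T)) ∈ K ∧ ‖D (u k)‖ ≤ R ∧
      energy α β (u k) w ≤ -inner ℝ (gradient f (u k : L2 T)) (u k : L2 T) by
    choose! w hw using H
    exact ⟨K, R, w, hK, hw⟩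
  intro k hk
  obtain ⟨-, lam, c, d, h0, huk, hsum⟩ := hrun.facts hT hf hk
  have hW := hrun.exists_isAtom hT hf k
  choose! W hW using hW
  have henergy : energy α β (u k) (∑ a ∈ A k, lam a • W a + affine hT 0 c) ≤
      -inner ℝ (gradient f (u k : L2 T)) (u k : L2 T) := by
    rw [← hsum, huk]
    exact energy_combination_le hT hα hβ (A k) lam h0 W (fun a ha => (hW a ha).energy_le hα hβ) c d
  have hval := hrun.subValue_le hT hf hL0 hL hk
  have hbv : bvNorm (u k) ≤ R := by
    refine hR _ (le_trans ?_ hval)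
    rw [J, subValue, sub_eq_add_neg, add_le_add_iff_left]
    exact (tgv_le_energy hα hβ _ _).trans henergy
  have hint : 0 ≤ ∫ x in Ioo 0 T, |(u k : L2 T) x| := integral_nonneg fun x => abs_nonneg _
  have hDn := radon_norm_nonneg (D (u k))
  rw [bvNorm] at hbv
  refine ⟨_, ?_, by linarith, henergy⟩
  have := hmem (A k) lam W c d h0 hW (by
    rw [hsum]
    rw [subValue] at hval
    linarith [hC (u k : L2 T)]) (by rw [← huk]; linarith)
  rwa [← huk] at this

end Run

lemma tendsto_dualp {T : ℝ} {ι : Type*} {l : Filter ι} {g : ι → L2 T} {g₀ : L2 T}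
    (h : Tendsto g l (𝓝 g₀)) {x : ℝ} (hx : x ∈ Icc 0 T) :
    Tendsto (fun i => dualp (g i) x) l (𝓝 (dualp g₀ x)) := by
  simp only [dualp_eq_inner _ hx]
  exact h.inner tendsto_const_nhds

lemma tendsto_dualP {T : ℝ} {ι : Type*} {l : Filter ι} {g : ι → L2 T} {g₀ : L2 T}
    (h : Tendsto g l (𝓝 g₀)) {x : ℝ} (hx : x ∈ Icc 0 T) :
    Tendsto (fun i => dualP (g i) x) l (𝓝 (dualP g₀ x)) := by
  have hm : MemLp (fun y => max (x - y) 0) 2 (volume.restrict (Ioo 0 T)) :=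
    memLp_of_continuous (by fun_prop)
  have e : ∀ g : L2 T, dualP g x = -inner ℝ g (hm.toLp _) := fun g => by
    rw [inner_max_sub g hx hm, neg_neg]
  simp only [e]
  exact (h.inner tendsto_const_nhds).neg

lemma neg_gradient_mem_subdiffTGV {T α β : ℝ} (hT : 0 < T) (hα : 0 < α) (hβ : 0 < β) {ι : Type*}
    (U : Ultrafilter ι) {u w : ι → BV T} {g : ι → L2 T} {ubar : BV T} {gbar y : L2 T}
    (hu : Tendsto (fun i => (u i : L2 T)) U (𝓝 (ubar : L2 T)))
    (hD : ∀ φ, Tendsto (fun i => D (u i) φ) U (𝓝 (D ubar φ)))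
    (hw : Tendsto (fun i => (w i : L2 T)) U (𝓝 y)) (hg : Tendsto g U (𝓝 gbar))
    (hort : ∀ᶠ i in U, IsOrthAffine (g i))
    (henergy : ∀ᶠ i in U, energy α β (u i) (w i) ≤ -inner ℝ (g i) (u i : L2 T))
    (hviol : Tendsto (fun i => violation α β (g i)) U (𝓝 1)) :
    -gbar ∈ subdiffTGV α β ubar := by
  have hort' : IsOrthAffine gbar := fun c d =>
    tendsto_nhds_unique (hg.inner tendsto_const_nhds)
      (tendsto_const_nhds.congr' (hort.mono fun i hi => (hi c d).symm))
  have hp : ∀ x ∈ Ioo 0 T, |dualp gbar x| ≤ α := fun x hx => by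
    refine le_of_tendsto_of_tendsto (tendsto_dualp hg ⟨hx.1.le, hx.2.le⟩).abs
      (by simpa using hviol.const_mul α) (Eventually.of_forall fun i => ?_)
    rw [mul_comm, ← div_le_iff₀ hα]
    refine le_trans ?_ (le_max_left _ _)
    gcongr
    exact abs_le_supNorm (continuousOn_dualp hT (g i)) ⟨x, hx⟩
  have hP : ∀ x ∈ Ioo 0 T, |dualP gbar x| ≤ β := fun x hx => by
    refine le_of_tendsto_of_tendsto (tendsto_dualP hg ⟨hx.1.le, hx.2.le⟩).abs
      (by simpa using hviol.const_mul β) (Eventually.of_forall fun i => ?_)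
    rw [mul_comm, ← div_le_iff₀ hβ]
    refine le_trans ?_ (le_max_right _ _)
    gcongr
    exact abs_le_supNorm (continuousOn_dualP hT (g i)) ⟨x, hx⟩
  have hub : tgv α β ubar ≤ -inner ℝ gbar (ubar : L2 T) :=
    tgv_le_of_tendsto hα hβ U hD hw (hg.inner hu).neg henergy
  intro v
  have hv := hort'.neg_inner_le_tgv hT hα hβ hp hP v
  rw [inner_neg_left, inner_sub_right]
  linarith

end TGV

end

theorem corollary5 (T α β : ℝ) (hT : 0 < T) (hα : 0 < α) (hβ : 0 < β)
    (f : TGV.L2 T → ℝ)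
    (hA1 : ContDiff ℝ 1 f)
    (hA2 : ∃ Lf : ℝ, 0 < Lf ∧
      ∀ u₁ u₂ : TGV.L2 T, ‖gradient f u₁ - gradient f u₂‖ ≤ Lf * ‖u₁ - u₂‖)
    (hA3 : ∃ Cf : ℝ, 0 < Cf ∧ ∀ u : TGV.L2 T, -Cf ≤ f u)
    (hA4 : ∀ c : ℝ, ∃ R : ℝ, ∀ u : TGV.BV T, TGV.J α β f u ≤ c → TGV.bvNorm u ≤ R)
    (A : ℕ → Finset (TGV.BV T)) (u : ℕ → TGV.BV T)
    (hrun : TGV.IsAlgorithmRun α β f A u) :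
    (∃ ubar : TGV.BV T, TGV.IsWeakStarAccPt u ubar ∧
      ∃ s : ℕ → ℕ, StrictMono s ∧ TGV.WeakStarTendsto (u ∘ s) ubar) ∧
    ∀ ubar : TGV.BV T, TGV.IsWeakStarAccPt u ubar →
      -gradient f (ubar : TGV.L2 T) ∈ TGV.subdiffTGV α β ubar := by
  obtain ⟨L, hL0, hL⟩ := hA2
  obtain ⟨C, -, hC⟩ := hA3
  have hf : Differentiable ℝ f := hA1.differentiable (by simp)
  have hcont : Continuous (gradient f) :=
    (LipschitzWith.of_dist_le_mul (K := ⟨L, hL0.le⟩) fun x y => by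
      rw [dist_eq_norm, dist_eq_norm]; exact hL x y).continuous
  have hviol := hrun.tendsto_violation hT hα hβ hf hL0.le hL hC
  obtain ⟨K, R, w, hK, hk⟩ := hrun.exists_compact hT hα hβ hf hL0.le hL hC hA4
  refine ⟨?_, fun ubar hacc => ?_⟩
  · obtain ⟨z, -, s, hs, hlim⟩ := hK.tendsto_subseq (x := fun n =>
      ((u (n + 1) : TGV.L2 T), (w (n + 1) : TGV.L2 T))) fun n => (hk (n + 1) (by omega)).1
    have hu : Tendsto (fun n => (u (s n + 1) : TGV.L2 T)) atTop (𝓝 z.1) :=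
      (continuous_fst.tendsto z).comp hlim
    obtain ⟨ubar, hubar, hD⟩ := TGV.exists_BV_limit hu (R := R)
      (Eventually.of_forall fun n => (hk (s n + 1) (by omega)).2.1)
    have hmono : StrictMono fun n => s n + 1 := fun a b hab => Nat.succ_lt_succ (hs hab)
    have hws : TGV.WeakStarTendsto (u ∘ fun n => s n + 1) ubar :=
      TGV.tendsto_weakStar_iff.2 ⟨TGV.tendsto_toRadon (hubar ▸ hu), hD⟩
    refine ⟨ubar, ?_, _, hmono, hws⟩
    let := TGV.weakStarTopology T
    exact MapClusterPt.of_comp hmono.tendsto_atTop hws.mapClusterPt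
  · letI := TGV.weakStarTopology T
    obtain ⟨U, hU, hlim⟩ := mapClusterPt_iff_ultrafilter.1 hacc
    obtain ⟨hR, hD⟩ := TGV.tendsto_weakStar_iff.1 hlim
    have hev : ∀ᶠ k in (U : Filter ℕ), 1 ≤ k := hU (eventually_ge_atTop 1)
    obtain ⟨z, -, hz⟩ := hK.ultrafilter_le_nhds'
      (U.map fun k => ((u k : TGV.L2 T), (w k : TGV.L2 T)))
      (by rw [Ultrafilter.mem_map]; filter_upwards [hev] with k h using (hk k h).1)
    have hu : Tendsto (fun k => (u k : TGV.L2 T)) U (𝓝 z.1) := (continuous_fst.tendsto z).comp hz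
    have hw : Tendsto (fun k => (w k : TGV.L2 T)) U (𝓝 z.2) := (continuous_snd.tendsto z).comp hz
    have hz1 : z.1 = ubar := TGV.toRadon_injective T <| DFunLike.ext _ _ fun φ =>
      tendsto_nhds_unique (TGV.tendsto_toRadon hu φ) (hR φ)
    rw [hz1] at hu
    exact TGV.neg_gradient_mem_subdiffTGV hT hα hβ U hu hD hw ((hcont.tendsto _).comp hu)
      (hev.mono fun k h => (hrun.facts hT hf h).1) (hev.mono fun k h => (hk k h).2.2)
      (hviol.mono_left hU)
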